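/- Let $\lambda>0$, let $k\ge 2$ be an integer, and let $w=p/q$ with relatively prime integers $0<p<q$. Let $\Pi$ be a homogeneous Poisson point process of intensity $\lambda$ on $(0,1]$. For a finite multiset $A$ of points of $(0,1]$ (points counted with multiplicity) put $S_w(A)=\max_{0\le t\le 1-w}|A\cap(t,t+w]|$, and let $\alpha=\mathbb{P}(S_w(\Pi)\ge k)$. Writing $\Pi\cup\{u\}$ for the multiset in which the multiplicity of $u$ is increased by one, define $$\nu(\Pi)=\sum_{Q\in\Pi,\;Q<1-w}\mathbf 1\bigl\{S_w(\Pi)<k,\ |\Pi\cap(Q,Q+w]|=k-2,\ |\Pi\cap(t,t+w]|\le k-2\text{ for all }t\text{ with }Q\le t\le Q+w\bigr\},$$ $$\tilde\nu(\Pi)=\sum_{Q\in\Pi}\mathbf 1\bigl\{S_w(\Pi)<k,\ S_w(\Pi\cup\{Q\})=k\bigr\}.$$ For $n=mq$ ($m=1,2,\dots$) with $n\ge\lambda$, let $H^n_1,\dots,H^n_n$ be i.i.d. with $\mathbb{P}(H^n_i=1)=\lambda/n=1-\mathbb{P}(H^n_i=0)$, and let $$\beta_n=\mathbb{P}\Bigl(\max_{1\le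 i\le n-nw+1}\ \sum_{r=i}^{i+nw-1}H^n_r\ \ge k\Bigr).$$ Then $\nu(\Pi)$ and $\tilde\nu(\Pi)$ are integrable, the function $u\mapsto\mathbb{P}(S_w(\Pi\cup\{u\})\ge k)$ is integrable on $[0,1]$, and, as $n\to\infty$ through the multiples $n=mq$ of $q$, $$\lim_{n\to\infty}\frac{2n}{\lambda^2}(\alpha-\beta_n)=\frac1\lambda\,\mathbb{E}\bigl[\nu(\Pi)+\tilde\nu(\Pi)\bigr]+\alpha-\int_0^1\mathbb{P}\Bigl(\max_{0\le t\le 1-w}\bigl|(\Pi\cup\{u\})\cap(t,t+w]\bigr|\ge k\Bigr)\,du.$$ -/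

import Mathlib

open MeasureTheory ProbabilityTheory Filter Topology

noncomputable section

open Classical in
/-- The number of points of the finite multiset `s`, with multiplicity, that lie in `B`. -/
def ptCount (s : Multiset ℝ) (B : Set ℝ) : ℕ :=
  s.countP (fun x => x ∈ B)

/-- The random finite set `X` is a homogeneous Poisson point process of intensity `lam` on the
interval `(0, 1]`: numbers of points in Borel sets are random variables, Poisson distributed with
mean `lam` times the length, and independent for pairwise disjoint sets. -/
structure IsPoissonProcess {Ω : Type*} [MeasurableSpace Ω] (lam : ℝ) (X : Ω → Finset ℝ)
    (P : Measure Ω) : Prop where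
  subset : ∀ ω, (X ω : Set ℝ) ⊆ Set.Ioc 0 1
  measurable_count : ∀ B : Set ℝ, MeasurableSet B → B ⊆ Set.Ioc 0 1 →
    Measurable (fun ω => ptCount (X ω).val B)
  map_count : ∀ B : Set ℝ, MeasurableSet B → B ⊆ Set.Ioc 0 1 →
    P.map (fun ω => ptCount (X ω).val B) = poissonMeasure (lam * volume.real B).toNNReal
  indep_count : ∀ (r : ℕ) (B : Fin r → Set ℝ), (∀ i, MeasurableSet (B i)) →
    (∀ i, B i ⊆ Set.Ioc 0 1) → Pairwise (fun i j => Disjoint (B i) (B j)) →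
    iIndepFun (fun i ω => ptCount (X ω).val (B i)) P

/-- The continuous scan statistic: the maximum over `0 ≤ t ≤ 1 - w` of the number of points of `s`
in the window `(t, t + w]`. For `w ≤ 1` this is a supremum of a nonempty set of natural numbers
that is bounded by the number of points, hence a maximum. -/
def scanStat (w : ℝ) (s : Multiset ℝ) : ℕ :=
  ⨆ t : Set.Icc (0 : ℝ) (1 - w), ptCount s (Set.Ioc (t : ℝ) (t + w))

open Classical in
/-- The number of points `x < 1 - w` of `s` such that the scan statistic of `s` is below `k`, the
window `(x, x + w]` has exactly `k - 2` points, and each window `(t, t + w]` with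
`x ≤ t ≤ x + w` has at most `k - 2` points. -/
def nuFun (w : ℝ) (k : ℕ) (s : Finset ℝ) : ℕ :=
  ∑ x ∈ s with x < 1 - w,
    if scanStat w s.val < k ∧ ptCount s.val (Set.Ioc x (x + w)) + 2 = k ∧
        ∀ t : ℝ, x ≤ t → t ≤ x + w → ptCount s.val (Set.Ioc t (t + w)) + 2 ≤ k
      then 1 else 0

/-- The number of points `x` of `s` such that the scan statistic of `s` is below `k`, and doubling
the multiplicity of `x` makes it equal to `k`. -/
def nuTildeFun (w : ℝ) (k : ℕ) (s : Finset ℝ) : ℕ :=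
  ∑ x ∈ s, if scanStat w s.val < k ∧ scanStat w (x ::ₘ s.val) = k then 1 else 0

/-- The discrete scan statistic: the maximum over all windows of `L` consecutive cells, among `n`
cells (numbered from `0`), of the sum of the entries `h r` in the window. It is used for `L ≤ n`. -/
def discreteScan {n : ℕ} (L : ℕ) (h : Fin n → ℕ) : ℕ :=
  (Finset.range (n - L + 1)).sup
    (fun i => ∑ r : Fin n with i ≤ r.val ∧ r.val < i + L, h r)

/-- The random variables `H r`, `r : Fin n`, are i.i.d. Bernoulli with success probability `a`. -/
structure IsBernoulliSeq {Ω : Type*} [MeasurableSpace Ω] {n : ℕ} (a : ℝ) (H : Fin n → Ω → ℕ)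
    (P : Measure Ω) : Prop where
  measurable : ∀ r, Measurable (H r)
  indep : iIndepFun H P
  prob_one : ∀ r, P.real {ω | H r ω = 1} = a
  prob_zero : ∀ r, P.real {ω | H r ω = 0} = 1 - a

end

/-! Write `n = m * q`, `L = m * p`, `a = lam / n`. Since `n * w = L` is an integer, windows of `L`
cells are continuous windows with endpoints on the grid. Let `α_n` be the probability that the
discrete scan of the Poisson cell counts reaches `k`. Then `α - β_n = (α - α_n) + (α_n - β_n)`, and
each difference is of order `1 / n` with its own limit.

The difference `α_n - β_n` only compares laws on the cells: independent Poisson(`a`) against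
independent Bernoulli(`a`) variables. To second order the two laws differ on a test function `h` by
`a² / 2 * (h 2 - 2 h 1 + h 0)`. Replacing the coordinates one at a time
(`abs_integral_pi_poisson_sub_bernoulli_le`) gives, after multiplication by `2n / lam²`, the average
over cells of `A 2 - 2 A 1 + A 0`, where `A c` is the probability of reaching `k` with that cell set
to `c`. The average of `A 0` tends to `α` and that of `A 1` to the integral over an added point `u`.
The average of `A 2 - A 1` counts single points whose doubling makes the scan reach `k`, hence the
term with `nuTildeFun`. This is `abs_poisson_sub_bernoulli_sub_le`, passed to the limit in
`IsPoissonProcess.tendsto_discrete_sub_bernoulli`.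

The difference `α - α_n` is the loss from looking at grid windows only. It is computed by comparing
the mesh with the halved mesh: `α_{2n} - α_n` is the probability that some window shifted by half a
cell reaches `k` while no unshifted one does. To leading order such a window has one point in each
of its two extreme half cells and `k - 2` between. Deleting and inserting points in the product law
turns this probability into `lam / (4n)` times the expectation of `gapCount`, with error `O(1 / n²)`
(`IsPoissonProcess.abs_refine_sub_le`). Almost surely `gapCount` is eventually `nuFun`. Summing the
geometric series of increments over successive halvings (`tendsto_mul_sub_of_doubling`) recovers `α
- α_n`. -/

noncomputable section

/-! ### Counting points -/

theorem ptCount_cons (u : ℝ) (s : Multiset ℝ) (B : Set ℝ) [Decidable (u ∈ B)] :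
    ptCount (u ::ₘ s) B = ptCount s B + if u ∈ B then 1 else 0 := by
  unfold ptCount
  rw [Multiset.countP_cons]
  congr

theorem ptCount_le_ptCount {s : Multiset ℝ} {B C : Set ℝ} (h : ∀ x ∈ s, x ∈ B → x ∈ C) :
    ptCount s B ≤ ptCount s C := by
  classical
  unfold ptCount
  rw [Multiset.countP_eq_card_filter, Multiset.countP_eq_card_filter]
  refine Multiset.card_le_card ?_
  rw [Multiset.le_filter]
  refine ⟨Multiset.filter_le _ _, fun x hx => ?_⟩
  rw [Multiset.mem_filter] at hx
  exact h x hx.1 hx.2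

theorem ptCount_congr {s : Multiset ℝ} {B C : Set ℝ} (h : ∀ x ∈ s, (x ∈ B ↔ x ∈ C)) :
    ptCount s B = ptCount s C :=
  le_antisymm (ptCount_le_ptCount fun x hx => (h x hx).1)
    (ptCount_le_ptCount fun x hx => (h x hx).2)

theorem ptCount_eq_card {s : Multiset ℝ} {B : Set ℝ} (h : ∀ x ∈ s, x ∈ B) :
    ptCount s B = s.card := by
  classical
  unfold ptCount
  exact Multiset.countP_eq_card.2 h

theorem ptCount_le_card (s : Multiset ℝ) (B : Set ℝ) : ptCount s B ≤ s.card := by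
  classical
  unfold ptCount
  exact Multiset.countP_le_card _ _

theorem ptCount_pos {s : Multiset ℝ} {B : Set ℝ} : 0 < ptCount s B ↔ ∃ x ∈ s, x ∈ B := by
  classical
  unfold ptCount
  exact Multiset.countP_pos

theorem ptCount_Ioc_add (s : Multiset ℝ) {a b c : ℝ} (hab : a ≤ b) (hbc : b ≤ c) :
    ptCount s (Set.Ioc a b) + ptCount s (Set.Ioc b c) = ptCount s (Set.Ioc a c) := by
  induction s using Multiset.induction_on with
  | empty => simp [ptCount]
  | cons u s ih =>
    classical
    rw [ptCount_cons, ptCount_cons, ptCount_cons, ← ih]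
    have : (if u ∈ Set.Ioc a c then 1 else 0 : ℕ) =
        (if u ∈ Set.Ioc a b then 1 else 0) + if u ∈ Set.Ioc b c then 1 else 0 := by
      simp only [Set.mem_Ioc]
      split_ifs <;> grind
    omega

/-- The numbers of points of `s` in the cells `(r / n, (r + 1) / n]`. -/
def cellCount (n : ℕ) (s : Multiset ℝ) (r : Fin n) : ℕ :=
  ptCount s (Set.Ioc ((r : ℝ) / n) (((r : ℝ) + 1) / n))

/-- The index of the cell `(r / n, (r + 1) / n]` that contains `u`. -/
def cellIndex (n : ℕ) (u : ℝ) : ℕ := ⌈n * u⌉₊ - 1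

theorem cellIndex_lt_mul {n : ℕ} (hn : 0 < n) {u : ℝ} (hu : 0 < u) :
    (cellIndex n u : ℝ) < n * u := by
  have h : 0 < (n : ℝ) * u := by positivity
  have h1 : 0 < ⌈(n : ℝ) * u⌉₊ := Nat.ceil_pos.2 h
  have h2 := Nat.ceil_lt_add_one h.le
  rw [cellIndex, Nat.cast_sub h1]
  push_cast
  linarith

theorem mul_le_cellIndex_add_one (n : ℕ) (u : ℝ) : n * u ≤ (cellIndex n u : ℝ) + 1 := by
  have h2 := Nat.le_ceil ((n : ℝ) * u)
  have : ⌈(n : ℝ) * u⌉₊ ≤ cellIndex n u + 1 := by unfold cellIndex; omega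
  have : (⌈(n : ℝ) * u⌉₊ : ℝ) ≤ (cellIndex n u : ℝ) + 1 := by exact_mod_cast this
  linarith

theorem mem_cell_iff {n : ℕ} (hn : 0 < n) {u : ℝ} (hu : 0 < u) (r : ℕ) :
    u ∈ Set.Ioc ((r : ℝ) / n) (((r : ℝ) + 1) / n) ↔ cellIndex n u = r := by
  have hn' : (0 : ℝ) < n := by exact_mod_cast hn
  have h1 := cellIndex_lt_mul hn hu
  have h2 := mul_le_cellIndex_add_one n u
  rw [Set.mem_Ioc, div_lt_iff₀ hn', le_div_iff₀ hn', mul_comm u]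
  constructor
  · rintro ⟨h3, h4⟩
    have h5 : (cellIndex n u : ℝ) < (r + 1 : ℕ) := by push_cast; linarith
    have h6 : (r : ℝ) < (cellIndex n u + 1 : ℕ) := by push_cast; linarith
    have := Nat.cast_lt.1 h5
    have := Nat.cast_lt.1 h6
    omega
  · rintro rfl
    exact ⟨h1, h2⟩

theorem cellIndex_lt {n : ℕ} (hn : 0 < n) {u : ℝ} (hu : 0 < u) (hu1 : u ≤ 1) :
    cellIndex n u < n := by
  have h1 := cellIndex_lt_mul hn hu
  have hn' : (0 : ℝ) < n := by exact_mod_cast hn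
  have : (cellIndex n u : ℝ) < n := by nlinarith
  exact_mod_cast this

theorem cellCount_cons {n : ℕ} (hn : 0 < n) {u : ℝ} (hu : 0 < u) (hu1 : u ≤ 1) (s : Multiset ℝ) :
    cellCount n (u ::ₘ s) =
      cellCount n s + Pi.single ⟨cellIndex n u, cellIndex_lt hn hu hu1⟩ 1 := by
  classical
  ext r
  rw [cellCount, ptCount_cons, Pi.add_apply, Pi.single_apply, cellCount]
  simp only [mem_cell_iff hn hu, Fin.ext_iff, eq_comm]

/-! ### Window sums -/

/-- The sum of `x r` over the `L` consecutive indices `r` starting at `i`. -/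
def windowSum {n : ℕ} (i L : ℕ) (x : Fin n → ℕ) : ℕ :=
  ∑ r : Fin n with i ≤ r.val ∧ r.val < i + L, x r

theorem windowSum_add_single {n : ℕ} (i L : ℕ) (x : Fin n → ℕ) (s : Fin n) :
    windowSum i L (x + Pi.single s 1) =
      windowSum i L x + if i ≤ s.val ∧ s.val < i + L then 1 else 0 := by
  simp only [windowSum, Pi.add_apply, Finset.sum_add_distrib, Pi.single_apply]
  rw [Finset.sum_ite_eq' _ s]
  simp

theorem windowSum_cellCount {n : ℕ} (i L : ℕ) (h : i + L ≤ n) (s : Multiset ℝ) :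
    windowSum i L (cellCount n s) = ptCount s (Set.Ioc ((i : ℝ) / n) (((i : ℝ) + L) / n)) := by
  have h1 : windowSum i L (cellCount n s) =
      ∑ r ∈ Finset.Ico i (i + L), ptCount s (Set.Ioc ((r : ℝ) / n) (((r : ℝ) + 1) / n)) := by
    unfold windowSum cellCount
    refine Finset.sum_bij (fun r _ => r.val) ?_ ?_ ?_ ?_
    · intro r hr
      simpa using hr
    · intro a _ b _ hab
      exact Fin.ext hab
    · intro b hb
      rw [Finset.mem_Ico] at hb
      exact ⟨⟨b, by omega⟩, by simpa using hb, rfl⟩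
    · intros; rfl
  rw [h1]
  clear h1 h
  induction L with
  | zero => simp [ptCount]
  | succ L ih =>
    rw [← add_assoc, Finset.sum_Ico_succ_top (by omega), ih]
    push_cast
    rw [ptCount_Ioc_add, add_assoc]
    · gcongr
      have : (0 : ℝ) ≤ L := by positivity
      linarith
    · exact div_le_div_of_nonneg_right (by linarith) (by positivity)

theorem le_discreteScan_iff {n L k : ℕ} (hk : 0 < k) (hL : L ≤ n) (h : Fin n → ℕ) :
    k ≤ discreteScan L h ↔ ∃ i, i + L ≤ n ∧ k ≤ windowSum i L h := by
  rw [discreteScan, Finset.le_sup_iff (by simpa using hk)]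
  refine exists_congr fun i => ?_
  rw [Finset.mem_range, windowSum]
  refine and_congr ?_ Iff.rfl
  omega

theorem bddAbove_scan (w : ℝ) (s : Multiset ℝ) :
    BddAbove (Set.range fun t : Set.Icc (0 : ℝ) (1 - w) => ptCount s (Set.Ioc (t : ℝ) (t + w))) :=
  ⟨s.card, by rintro _ ⟨t, rfl⟩; exact ptCount_le_card _ _⟩

theorem ptCount_le_scanStat {w : ℝ} (s : Multiset ℝ) {t : ℝ} (ht : 0 ≤ t) (ht' : t ≤ 1 - w) :
    ptCount s (Set.Ioc t (t + w)) ≤ scanStat w s :=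
  le_ciSup (bddAbove_scan w s) (⟨t, ht, ht'⟩ : Set.Icc (0 : ℝ) (1 - w))

theorem exists_scanStat_eq {w : ℝ} (hw : w ≤ 1) (s : Multiset ℝ) :
    ∃ t, 0 ≤ t ∧ t ≤ 1 - w ∧ scanStat w s = ptCount s (Set.Ioc t (t + w)) := by
  have : Nonempty (Set.Icc (0 : ℝ) (1 - w)) := ⟨⟨0, le_rfl, by linarith⟩⟩
  obtain ⟨t, ht⟩ := Nat.sSup_mem (Set.range_nonempty _) (bddAbove_scan w s)
  exact ⟨t, t.2.1, t.2.2, ht.symm⟩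

theorem scanStat_cons_le {w : ℝ} (hw : w ≤ 1) (u : ℝ) (s : Multiset ℝ) :
    scanStat w (u ::ₘ s) ≤ scanStat w s + 1 := by
  classical
  obtain ⟨t, h0, h1, h⟩ := exists_scanStat_eq hw (u ::ₘ s)
  rw [h, ptCount_cons]
  have := ptCount_le_scanStat s h0 h1
  split_ifs <;> omega

theorem scanStat_le_cons {w : ℝ} (hw : w ≤ 1) (u : ℝ) (s : Multiset ℝ) :
    scanStat w s ≤ scanStat w (u ::ₘ s) := by
  classical
  obtain ⟨t, h0, h1, h⟩ := exists_scanStat_eq hw s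
  rw [h]
  refine le_trans ?_ (ptCount_le_scanStat (u ::ₘ s) h0 h1)
  rw [ptCount_cons]
  omega

theorem le_scanStat_of_le_discreteScan {n L k : ℕ} (hk : 0 < k) (hn : 0 < n) (hL : L ≤ n) {w : ℝ}
    (hw : n * w = L) {s : Multiset ℝ} (h : k ≤ discreteScan L (cellCount n s)) :
    k ≤ scanStat w s := by
  obtain ⟨i, hi, hk⟩ := (le_discreteScan_iff hk hL _).1 h
  have hn' : (0 : ℝ) < n := by exact_mod_cast hn
  rw [windowSum_cellCount _ _ hi] at hk
  have h2 : ((i : ℝ) + L) / n = i / n + w := by rw [← hw]; field_simp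
  rw [h2] at hk
  refine hk.trans (ptCount_le_scanStat s (by positivity) ?_)
  have : (i : ℝ) + L ≤ n := by exact_mod_cast hi
  have h3 : ((i : ℝ) + L) / n ≤ 1 := by rw [div_le_one hn']; exact this
  linarith

/-- A window count of the continuous scan is attained by a discrete window, once the mesh is
smaller than the slack between the window length and the spread of the points in the window. -/
theorem eventually_le_discreteScan {p q k : ℕ} (hk : 0 < k) (hpq : p < q) {w : ℝ}
    (hw : w = (p : ℝ) / q) {s : Multiset ℝ} (hs : ∀ x ∈ s, x ∈ Set.Ioc (0 : ℝ) 1)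
    (h : k ≤ scanStat w s) :
    ∀ᶠ m : ℕ in atTop, k ≤ discreteScan (m * p) (cellCount (m * q) s) := by
  classical
  have hq : (0 : ℝ) < q := by exact_mod_cast (by omega : 0 < q)
  have hw1 : w ≤ 1 := by
    rw [hw, div_le_one hq]; exact_mod_cast hpq.le
  obtain ⟨t, ht0, ht1, ht⟩ := exists_scanStat_eq hw1 s
  rw [ht] at h
  set F := s.toFinset.filter (fun x => x ∈ Set.Ioc t (t + w)) with hF
  have hne : F.Nonempty := by
    obtain ⟨x, hx, hx'⟩ := ptCount_pos.1 (hk.trans_le h)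
    exact ⟨x, by simp only [hF, Finset.mem_filter, Multiset.mem_toFinset]; exact ⟨hx, hx'⟩⟩
  have hxF := F.min'_mem hne
  have hyF := F.max'_mem hne
  set x := F.min' hne with hx
  set y := F.max' hne with hy
  simp only [hF, Finset.mem_filter, Multiset.mem_toFinset, Set.mem_Ioc] at hxF hyF
  -- The window is open on the left, so its extreme points `x` and `y` are strictly closer than `w`.
  -- This slack absorbs the rounding of the left end to the grid.
  have hd : 0 < w - (y - x) := by linarith [hxF.2.1, hyF.2.2]
  have hlim : Tendsto (fun m : ℕ => ((m : ℝ) * q) * (w - (y - x))) atTop atTop :=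
    (tendsto_natCast_atTop_atTop.atTop_mul_const hq).atTop_mul_const hd
  filter_upwards [hlim.eventually_ge_atTop 1, eventually_gt_atTop 0] with m hm hm0
  have hn : 0 < m * q := Nat.mul_pos hm0 (by omega)
  have hn' : (0 : ℝ) < ((m * q : ℕ) : ℝ) := by exact_mod_cast hn
  have hL : m * p ≤ m * q := Nat.mul_le_mul_left _ hpq.le
  have hnw : ((m * q : ℕ) : ℝ) * w = (m * p : ℕ) := by rw [hw]; push_cast; field_simp
  rw [← Nat.cast_mul] at hm
  generalize m * q = n at *
  generalize m * p = L at *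
  have hx0 := (hs x hxF.1).1
  have h1 := cellIndex_lt_mul hn hx0
  have h2 := mul_le_cellIndex_add_one n x
  rw [le_discreteScan_iff hk hL]
  -- The window starts with the cell of `x`, unless it would stick out beyond `1`. In that case the
  -- last window is used, which reaches `1` and hence covers every point to the right of its start.
  refine ⟨min (cellIndex n x) (n - L), by omega, h.trans ?_⟩
  rw [windowSum_cellCount _ _ (by omega)]
  refine ptCount_le_ptCount fun z hz hzt => ?_
  have hzF : z ∈ F := by
    simp only [hF, Finset.mem_filter, Multiset.mem_toFinset]; exact ⟨hz, hzt⟩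
  have hxz : x ≤ z := F.min'_le z hzF
  have hzy : z ≤ y := F.le_max' z hzF
  rw [Set.mem_Ioc, div_lt_iff₀ hn', le_div_iff₀ hn']
  constructor
  · have : ((min (cellIndex n x) (n - L) : ℕ) : ℝ) ≤ cellIndex n x := by
      exact_mod_cast min_le_left _ _
    nlinarith
  · rcases le_total (cellIndex n x) (n - L) with hc | hc
    · rw [min_eq_left hc]
      nlinarith
    · rw [min_eq_right hc, Nat.cast_sub hL]
      have := (hs z hz).2
      nlinarith

theorem eventually_le_discreteScan_iff {p q k : ℕ} (hk : 0 < k) (hpq : p < q) {w : ℝ}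
    (hw : w = (p : ℝ) / q) {s : Multiset ℝ} (hs : ∀ x ∈ s, x ∈ Set.Ioc (0 : ℝ) 1) :
    ∀ᶠ m : ℕ in atTop, (k ≤ discreteScan (m * p) (cellCount (m * q) s) ↔ k ≤ scanStat w s) := by
  have hq : (0 : ℝ) < q := by exact_mod_cast (by omega : 0 < q)
  have key : ∀ m : ℕ, 0 < m → k ≤ discreteScan (m * p) (cellCount (m * q) s) →
      k ≤ scanStat w s := by
    intro m hm h
    refine le_scanStat_of_le_discreteScan hk (Nat.mul_pos hm (by omega))
      (Nat.mul_le_mul_left _ hpq.le) ?_ h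
    rw [hw]; push_cast; field_simp
  by_cases h : k ≤ scanStat w s
  · filter_upwards [eventually_le_discreteScan hk hpq hw hs h] with m hm
    exact ⟨fun _ => h, fun _ => hm⟩
  · filter_upwards [eventually_gt_atTop 0] with m hm
    exact ⟨key m hm, fun h' => absurd h' h⟩

/-! ### Resampling one coordinate of a product measure -/

theorem map_update_pi_prod {ι : Type*} [Fintype ι] [DecidableEq ι] (μ κ : ι → Measure ℕ)
    [∀ i, IsProbabilityMeasure (μ i)] [∀ i, IsProbabilityMeasure (κ i)] (j : ι)
    (h : ∀ i, i ≠ j → κ i = μ i) :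
    ((Measure.pi μ).prod (κ j)).map (fun z => Function.update z.1 j z.2) = Measure.pi κ := by
  refine (Measure.pi_eq fun s hs => ?_).symm
  rw [Measure.map_apply .of_discrete (MeasurableSet.univ_pi hs)]
  have : (fun z : (ι → ℕ) × ℕ => Function.update z.1 j z.2) ⁻¹' Set.univ.pi s =
      (Set.univ.pi (Function.update s j Set.univ)) ×ˢ s j := by
    ext z
    simp only [Set.mem_preimage, Set.mem_pi, Set.mem_univ, true_implies, Set.mem_prod]
    constructor
    · intro hz
      refine ⟨fun i => ?_, by simpa using hz j⟩
      by_cases hi : i = j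
      · subst hi; simp
      · simpa [hi] using hz i
    · rintro ⟨h1, h2⟩ i
      by_cases hi : i = j
      · subst hi; simpa using h2
      · simpa [hi] using h1 i
  rw [this, Measure.prod_prod, Measure.pi_pi]
  rw [← Finset.mul_prod_erase _ _ (Finset.mem_univ j),
    ← Finset.mul_prod_erase Finset.univ (fun i => κ i (s i)) (Finset.mem_univ j)]
  simp only [Function.update_self, measure_univ, one_mul]
  rw [mul_comm]
  congr 1
  refine Finset.prod_congr rfl fun i hi => ?_
  rw [Finset.mem_erase] at hi
  rw [Function.update_of_ne hi.1, h i hi.1]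

theorem integrable_of_abs_le {α : Type*} [MeasurableSpace α] [DiscreteMeasurableSpace α]
    [Countable α] (μ : Measure α) [IsFiniteMeasure μ] {F : α → ℝ} {C : ℝ} (hF : ∀ x, |F x| ≤ C) :
    Integrable F μ :=
  Integrable.of_bound (Measurable.of_discrete).aestronglyMeasurable C
    (Eventually.of_forall fun x => by simpa using hF x)

theorem abs_integral_le_of_abs_le {α : Type*} [MeasurableSpace α] (μ : Measure α)
    [IsProbabilityMeasure μ] {F : α → ℝ} {C : ℝ} (hF : ∀ x, |F x| ≤ C) :
    |∫ x, F x ∂μ| ≤ C := by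
  have := norm_integral_le_of_norm_le_const (μ := μ) (f := F) (C := C)
    (Eventually.of_forall fun x => by simpa using hF x)
  simpa using this

theorem integral_pi_eq_integral_update {ι : Type*} [Fintype ι] [DecidableEq ι]
    (μ κ : ι → Measure ℕ) [∀ i, IsProbabilityMeasure (μ i)] [∀ i, IsProbabilityMeasure (κ i)]
    (j : ι) (h : ∀ i, i ≠ j → κ i = μ i) {F : (ι → ℕ) → ℝ} {C : ℝ} (hF : ∀ x, |F x| ≤ C) :
    ∫ x, F x ∂(Measure.pi κ) =
      ∫ x, (∫ y, F (Function.update x j y) ∂(κ j)) ∂(Measure.pi μ) := by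
  rw [← map_update_pi_prod μ κ j h, integral_map Measurable.of_discrete.aemeasurable
    Measurable.of_discrete.aestronglyMeasurable, integral_prod]
  exact integrable_of_abs_le _ fun z => hF _

theorem measureReal_pi_eq_and {ι : Type*} [Fintype ι] [DecidableEq ι] (μ : ι → Measure ℕ)
    [∀ i, IsProbabilityMeasure (μ i)] (j : ι) (c : ℕ) (G : (ι → ℕ) → Prop) :
    (Measure.pi μ).real {x | x j = c ∧ G x} =
      (μ j).real {c} * (Measure.pi μ).real {x | G (Function.update x j c)} := by
  conv_lhs => rw [← map_update_pi_prod μ μ j fun _ _ => rfl]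
  rw [map_measureReal_apply .of_discrete .of_discrete]
  have : (fun z : (ι → ℕ) × ℕ => Function.update z.1 j z.2) ⁻¹' {x | x j = c ∧ G x} =
      {x | G (Function.update x j c)} ×ˢ {c} := by
    ext z
    simp only [Set.mem_preimage, Set.mem_ofPred_eq, Function.update_self, Set.mem_prod,
      Set.mem_singleton_iff]
    constructor
    · rintro ⟨h1, h2⟩
      exact ⟨h1 ▸ h2, h1⟩
    · rintro ⟨h1, h2⟩
      exact ⟨h2, h2 ▸ h1⟩
  rw [this, measureReal_prod_prod, mul_comm]

/-- A discrete Mecke formula: by independence, a single point in coordinate `j` can be removed at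
the price of the factor `a`, provided it is put back inside the event. -/
theorem measureReal_pi_one_eq {ι : Type*} [Fintype ι] [DecidableEq ι] (μ : ι → Measure ℕ)
    [∀ i, IsProbabilityMeasure (μ i)] (j : ι) {a : ℝ} (h : (μ j).real {1} = a * (μ j).real {0})
    (G : (ι → ℕ) → Prop) :
    (Measure.pi μ).real {x | x j = 1 ∧ G x} =
      a * (Measure.pi μ).real {x | x j = 0 ∧ G (x + Pi.single j 1)} := by
  have e : (Measure.pi μ).real {x | x j = 0 ∧ G (x + Pi.single j 1)} =
      (μ j).real {0} * (Measure.pi μ).real {x | G (Function.update x j 0 + Pi.single j 1)} :=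
    measureReal_pi_eq_and μ j 0 (fun x => G (x + Pi.single j 1))
  rw [measureReal_pi_eq_and, e, h]
  have : ∀ x : ι → ℕ, Function.update x j 0 + Pi.single j 1 = Function.update x j 1 := by
    intro x
    ext i
    by_cases hi : i = j
    · subst hi; simp
    · simp [hi]
  simp only [this]
  ring

theorem measureReal_pi_forall_mem {ι : Type*} [Fintype ι] (μ : ι → Measure ℕ)
    [∀ i, IsProbabilityMeasure (μ i)] (S : Finset ι) (B : ι → Set ℕ) :
    (Measure.pi μ).real {x | ∀ j ∈ S, x j ∈ B j} = ∏ j ∈ S, (μ j).real (B j) := by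
  have := Measure.pi_pi_finset μ B S
  rw [measureReal_def]
  simp only [measureReal_def]
  rw [← ENNReal.toReal_prod, ← this]
  rfl

/-! ### The Poisson and the Bernoulli distribution -/

theorem poisson_real_zero {a : ℝ} (ha : 0 ≤ a) :
    (poissonMeasure a.toNNReal).real {0} = Real.exp (-a) := by
  rw [poissonMeasure_real_singleton, Real.coe_toNNReal a ha]; simp

theorem poisson_real_one {a : ℝ} (ha : 0 ≤ a) :
    (poissonMeasure a.toNNReal).real {1} = a * Real.exp (-a) := by
  rw [poissonMeasure_real_singleton, Real.coe_toNNReal a ha]; simp [mul_comm]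

theorem poisson_real_two {a : ℝ} (ha : 0 ≤ a) :
    (poissonMeasure a.toNNReal).real {2} = a ^ 2 / 2 * Real.exp (-a) := by
  rw [poissonMeasure_real_singleton, Real.coe_toNNReal a ha]; simp [Nat.factorial]; ring

theorem poisson_real_pos_le {a : ℝ} (ha : 0 ≤ a) :
    (poissonMeasure a.toNNReal).real {y | 1 ≤ y} ≤ a := by
  have h : {y : ℕ | 1 ≤ y} = ({0} : Set ℕ)ᶜ := by ext; simp; omega
  rw [h, probReal_compl_eq_one_sub .of_discrete, poisson_real_zero ha]
  have := Real.add_one_le_exp (-a)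
  linarith

theorem poisson_real_two_le {a : ℝ} (ha : 0 ≤ a) :
    (poissonMeasure a.toNNReal).real {y | 2 ≤ y} ≤ a ^ 2 := by
  have h : {y : ℕ | 2 ≤ y} = ({0} ∪ {1} : Set ℕ)ᶜ := by ext; simp; omega
  rw [h, probReal_compl_eq_one_sub .of_discrete, measureReal_union (by simp) .of_discrete,
    poisson_real_zero ha, poisson_real_one ha]
  have := Real.add_one_le_exp (-a)
  nlinarith

theorem integrable_natCast_poisson (r : NNReal) :
    Integrable (fun y : ℕ => (y : ℝ)) (poissonMeasure r) := by
  rw [integrable_poissonMeasure_iff, ← summable_nat_add_iff 1]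
  have := (hasSum_one_poissonMeasure r).summable.mul_left (r : ℝ)
  refine this.congr fun n => ?_
  rw [Nat.factorial_succ]
  push_cast
  rw [Real.norm_eq_abs, abs_of_nonneg (by positivity)]
  field_simp
  ring

/-- Truncation error for the expectation of a function bounded by `1`. -/
theorem abs_integral_sub_sum_le (μ : Measure ℕ) [IsProbabilityMeasure μ] {h : ℕ → ℝ}
    (hh : ∀ y, |h y| ≤ 1) (n : ℕ) :
    |∫ y, h y ∂μ - ∑ i ∈ Finset.range n, μ.real {i} * h i| ≤
      1 - ∑ i ∈ Finset.range n, μ.real {i} := by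
  have hint := integrable_of_abs_le μ hh
  have hsum : ∑ i ∈ Finset.range n, μ.real {i} = μ.real (Finset.range n : Set ℕ) :=
    sum_measureReal_singleton _
  rw [← integral_add_compl (s := (Finset.range n : Set ℕ)) .of_discrete hint,
    setIntegral_finset _ hint.integrableOn]
  simp only [smul_eq_mul, add_sub_cancel_left]
  rw [hsum, ← probReal_compl_eq_one_sub .of_discrete]
  have := norm_setIntegral_le_of_norm_le_const (μ := μ) (s := (Finset.range n : Set ℕ)ᶜ) (f := h)
    (C := 1) (by finiteness) (fun x _ => by simpa using hh x)
  simpa using this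

/-- The masses at `0` and `1` add up to one, so the truncation error after two terms vanishes. The
support of `b` need not be specified separately. -/
theorem integral_bernoulli (b : Measure ℕ) [IsProbabilityMeasure b] {a : ℝ}
    (h0 : b.real {0} = 1 - a) (h1 : b.real {1} = a) {h : ℕ → ℝ} (hh : ∀ y, |h y| ≤ 1) :
    ∫ y, h y ∂b = (1 - a) * h 0 + a * h 1 := by
  have := abs_integral_sub_sum_le b hh 2
  simp only [Finset.sum_range_succ, Finset.sum_range_zero, h0, h1] at this
  have h2 : (1 : ℝ) - (0 + (1 - a) + a) = 0 := by ring
  rw [h2] at this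
  have := abs_nonpos_iff.1 this
  linarith

/-- Up to `O(a³)` the Poisson weights at `0, 1, 2` are `1 - a + a²/2`, `a - a²`, `a²/2`. Subtracting
the weights `1 - a`, `a`, `0` leaves `a²/2` times the second difference. The errors `e1` to `e4` at
`0`, `1`, `2` and in the tail are each at most `a³`. -/
theorem abs_integral_poisson_sub_bernoulli_le (b : Measure ℕ) [IsProbabilityMeasure b] {a : ℝ}
    (ha : 0 ≤ a) (ha1 : a ≤ 1) (h0 : b.real {0} = 1 - a) (h1 : b.real {1} = a) {h : ℕ → ℝ}
    (hh : ∀ y, |h y| ≤ 1) :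
    |∫ y, h y ∂(poissonMeasure a.toNNReal) - ∫ y, h y ∂b -
      a ^ 2 / 2 * (h 2 - 2 * h 1 + h 0)| ≤ 5 * a ^ 3 := by
  rw [integral_bernoulli b h0 h1 hh]
  have ht := abs_integral_sub_sum_le (poissonMeasure a.toNNReal) hh 3
  simp only [Finset.sum_range_succ, Finset.sum_range_zero, poisson_real_zero ha,
    poisson_real_one ha, poisson_real_two ha, zero_add] at ht
  have he := Real.exp_bound (x := -a) (n := 3) (by rwa [abs_neg, abs_of_nonneg ha]) (by norm_num)
  simp only [Finset.sum_range_succ, Finset.sum_range_zero, Nat.factorial, abs_neg,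
    abs_of_nonneg ha] at he
  norm_num at he
  have he2 : Real.exp (-a) - (1 - a + a ^ 2 / 2) ≤ a ^ 3 * (2 / 9) := by
    have := (abs_le.1 he).2; linarith
  have he3 : -(a ^ 3 * (2 / 9)) ≤ Real.exp (-a) - (1 - a + a ^ 2 / 2) := by
    have := (abs_le.1 he).1; linarith
  set e := Real.exp (-a) with hedef
  have ha2 : 0 ≤ a ^ 2 := by positivity
  have ha3 : 0 ≤ a ^ 3 := by positivity
  have h32 : a ^ 3 ≤ a ^ 2 := by nlinarith
  have e1 : |(e - (1 - a) - a ^ 2 / 2) * h 0| ≤ a ^ 3 * (2 / 9) := by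
    rw [abs_mul]
    refine mul_le_of_le_one_right (by positivity) (hh 0) |>.trans ?_
    rw [abs_le]; constructor <;> linarith
  have e2 : |(a * (e - 1 + a)) * h 1| ≤ a ^ 3 := by
    rw [abs_mul]
    refine mul_le_of_le_one_right (by positivity) (hh 1) |>.trans ?_
    rw [abs_mul, abs_of_nonneg ha]
    have : |e - 1 + a| ≤ a ^ 2 := by rw [abs_le]; constructor <;> linarith
    calc a * |e - 1 + a| ≤ a * a ^ 2 := by gcongr
      _ = a ^ 3 := by ring
  have e3 : |(a ^ 2 / 2 * (e - 1)) * h 2| ≤ a ^ 3 := by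
    rw [abs_mul]
    refine mul_le_of_le_one_right (by positivity) (hh 2) |>.trans ?_
    rw [abs_mul, abs_of_nonneg (by positivity)]
    have : |e - 1| ≤ 2 * a := by
      rw [abs_le]; constructor <;> nlinarith
    calc a ^ 2 / 2 * |e - 1| ≤ a ^ 2 / 2 * (2 * a) := by gcongr
      _ = a ^ 3 := by ring
  have e4 : 1 - (e + a * e + a ^ 2 / 2 * e) ≤ a ^ 3 := by
    have h5 : (1 - a + a ^ 2 / 2 - a ^ 3 * (2 / 9)) * (1 + a + a ^ 2 / 2) ≤
        e * (1 + a + a ^ 2 / 2) := by gcongr; linarith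
    have h6 : 1 - a ^ 3 ≤ (1 - a + a ^ 2 / 2 - a ^ 3 * (2 / 9)) * (1 + a + a ^ 2 / 2) := by
      have h7 : (1 - a + a ^ 2 / 2 - a ^ 3 * (2 / 9)) * (1 + a + a ^ 2 / 2) - (1 - a ^ 3) =
        a ^ 3 * (7 / 9 + a / 36 - a ^ 2 / 9) := by ring
      have h8 : 0 ≤ a ^ 3 * (7 / 9 + a / 36 - a ^ 2 / 9) := mul_nonneg ha3 (by nlinarith)
      linarith
    linarith
  rw [abs_le] at *
  constructor <;> linarith [e1.1, e1.2, e2.1, e2.2, e3.1, e3.2, ht.1, ht.2]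

/-! ### Replacing Poisson coordinates by Bernoulli coordinates -/

/-- Coordinates in `S` have distribution `b`, the others have distribution `μ`. -/
def hybrid {ι : Type*} [DecidableEq ι] (μ b : Measure ℕ) (S : Finset ι) (i : ι) : Measure ℕ :=
  if i ∈ S then b else μ

instance {ι : Type*} [DecidableEq ι] (μ b : Measure ℕ) [IsProbabilityMeasure μ]
    [IsProbabilityMeasure b] (S : Finset ι) (i : ι) : IsProbabilityMeasure (hybrid μ b S i) := by
  unfold hybrid
  split_ifs <;> infer_instance

/-- One Lindeberg step: the two product measures differ in coordinate `j` only, so the one-variable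
expansion applies with the other coordinates frozen. -/
theorem abs_integral_hybrid_insert_sub_le {ι : Type*} [Fintype ι] [DecidableEq ι]
    (b : Measure ℕ) [IsProbabilityMeasure b] {a : ℝ}
    (ha : 0 ≤ a) (ha1 : a ≤ 1) (h0 : b.real {0} = 1 - a) (h1 : b.real {1} = a)
    {F : (ι → ℕ) → ℝ} (hF : ∀ x, |F x| ≤ 1) (S : Finset ι) (j : ι) (hj : j ∉ S) :
    |∫ x, F x ∂(Measure.pi (hybrid (poissonMeasure a.toNNReal) b S)) -
      ∫ x, F x ∂(Measure.pi (hybrid (poissonMeasure a.toNNReal) b (insert j S))) -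
      a ^ 2 / 2 * ∫ x, (F (Function.update x j 2) - 2 * F (Function.update x j 1) +
        F (Function.update x j 0)) ∂(Measure.pi (hybrid (poissonMeasure a.toNNReal) b S))| ≤
      5 * a ^ 3 := by
  set μ := poissonMeasure a.toNNReal
  have hb : ∀ (ν : Measure ℕ) [IsProbabilityMeasure ν] (x : ι → ℕ),
      |∫ y, F (Function.update x j y) ∂ν| ≤ 1 := fun ν _ x =>
    abs_integral_le_of_abs_le ν fun y => hF _
  have e1 := integral_pi_eq_integral_update (hybrid μ b S) (hybrid μ b S) j
    (fun _ _ => rfl) hF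
  have e2 := integral_pi_eq_integral_update (hybrid μ b S) (hybrid μ b (insert j S)) j
    (fun i hi => by simp [hybrid, hi]) hF
  have e3 : hybrid μ b S j = μ := by simp [hybrid, hj]
  have e4 : hybrid μ b (insert j S) j = b := by simp [hybrid]
  rw [e3] at e1
  rw [e4] at e2
  have hD : ∀ x : ι → ℕ, |F (Function.update x j 2) - 2 * F (Function.update x j 1) +
        F (Function.update x j 0)| ≤ 4 := by
    intro x
    have g0 := abs_le.1 (hF (Function.update x j 0))
    have g1 := abs_le.1 (hF (Function.update x j 1))
    have g2 := abs_le.1 (hF (Function.update x j 2))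
    rw [abs_le]
    constructor <;> linarith [g0.1, g0.2, g1.1, g1.2, g2.1, g2.2]
  rw [e1, e2, ← integral_const_mul, ← integral_sub, ← integral_sub]
  · exact abs_integral_le_of_abs_le _ fun x =>
      abs_integral_poisson_sub_bernoulli_le b ha ha1 h0 h1 fun y => hF _
  · exact (integrable_of_abs_le _ (hb μ)).sub (integrable_of_abs_le _ (hb b))
  · exact (integrable_of_abs_le _ hD).const_mul _
  · exact integrable_of_abs_le _ (hb μ)
  · exact integrable_of_abs_le _ (hb b)

/-- A crude first bound, used to move the second-difference terms from a hybrid law back to the pure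
Poisson law. Each replacement costs at most `4 * a² / 2 + 5 * a³ ≤ 7 * a²`. -/
theorem abs_integral_hybrid_sub_le {ι : Type*} [Fintype ι] [DecidableEq ι]
    (b : Measure ℕ) [IsProbabilityMeasure b] {a : ℝ}
    (ha : 0 ≤ a) (ha1 : a ≤ 1) (h0 : b.real {0} = 1 - a) (h1 : b.real {1} = a)
    {F : (ι → ℕ) → ℝ} (hF : ∀ x, |F x| ≤ 1) (S : Finset ι) :
    |∫ x, F x ∂(Measure.pi (hybrid (poissonMeasure a.toNNReal) b ∅)) -
      ∫ x, F x ∂(Measure.pi (hybrid (poissonMeasure a.toNNReal) b S))| ≤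
      S.card * (7 * a ^ 2) := by
  induction S using Finset.induction_on with
  | empty => simp
  | insert j S hj ih =>
    have key := abs_integral_hybrid_insert_sub_le b ha ha1 h0 h1 hF S j hj
    rw [Finset.card_insert_of_notMem hj]
    push_cast
    have hD := abs_integral_le_of_abs_le (C := 4)
      (Measure.pi (hybrid (poissonMeasure a.toNNReal) b S))
      (F := fun x => F (Function.update x j 2) - 2 * F (Function.update x j 1) +
        F (Function.update x j 0)) (by
        intro x
        have g0 := abs_le.1 (hF (Function.update x j 0))
        have g1 := abs_le.1 (hF (Function.update x j 1))
        have g2 := abs_le.1 (hF (Function.update x j 2))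
        rw [abs_le]
        constructor <;> linarith [g0.1, g0.2, g1.1, g1.2, g2.1, g2.2])
    have h3 : a ^ 3 ≤ a ^ 2 := by nlinarith [sq_nonneg a]
    have h2 : 0 ≤ a ^ 2 := by positivity
    rw [abs_le] at *
    constructor <;> nlinarith [key.1, key.2, ih.1, ih.2, hD.1, hD.2]

/-- Second-order expansion of the effect of replacing i.i.d. Poisson variables by i.i.d. Bernoulli
variables with the same mean. -/
theorem abs_integral_pi_poisson_sub_bernoulli_le {ι : Type*} [Fintype ι] [DecidableEq ι]
    (b : Measure ℕ) [IsProbabilityMeasure b] {a : ℝ}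
    (ha : 0 ≤ a) (ha1 : a ≤ 1) (h0 : b.real {0} = 1 - a) (h1 : b.real {1} = a)
    {F : (ι → ℕ) → ℝ} (hF : ∀ x, |F x| ≤ 1) :
    |∫ x, F x ∂(Measure.pi fun _ => poissonMeasure a.toNNReal) -
      ∫ x, F x ∂(Measure.pi fun _ => b) -
      a ^ 2 / 2 * ∑ j, ∫ x, (F (Function.update x j 2) - 2 * F (Function.update x j 1) +
        F (Function.update x j 0)) ∂(Measure.pi fun _ => poissonMeasure a.toNNReal)| ≤
      Fintype.card ι * (5 * a ^ 3 + Fintype.card ι * (14 * a ^ 4)) := by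
  have hE : hybrid (ι := ι) (poissonMeasure a.toNNReal) b ∅ =
      fun _ => poissonMeasure a.toNNReal := by ext1 i; simp [hybrid]
  have hU : hybrid (ι := ι) (poissonMeasure a.toNNReal) b Finset.univ =
      fun _ => b := by ext1 i; simp [hybrid]
  have main : ∀ S : Finset ι,
      |∫ x, F x ∂(Measure.pi (hybrid (poissonMeasure a.toNNReal) b ∅)) -
      ∫ x, F x ∂(Measure.pi (hybrid (poissonMeasure a.toNNReal) b S)) -
      a ^ 2 / 2 * ∑ j ∈ S, ∫ x, (F (Function.update x j 2) - 2 * F (Function.update x j 1) +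
        F (Function.update x j 0)) ∂(Measure.pi (hybrid (poissonMeasure a.toNNReal) b ∅))| ≤
      S.card * (5 * a ^ 3 + Fintype.card ι * (14 * a ^ 4)) := by
    intro S
    induction S using Finset.induction_on with
    | empty => simp
    | insert j S hj ih =>
      have key := abs_integral_hybrid_insert_sub_le b ha ha1 h0 h1 hF S j hj
      -- The second difference is bounded by `4`, so the factor `1 / 4` makes the crude bound
      -- applicable. Undoing it gives `4 * 7 = 28`, and the prefactor `a² / 2` then yields the
      -- constant `14`.
      have hD := abs_integral_hybrid_sub_le b ha ha1 h0 h1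
        (F := fun x => 1 / 4 * (F (Function.update x j 2) - 2 * F (Function.update x j 1) +
          F (Function.update x j 0))) (by
          intro x
          have g0 := abs_le.1 (hF (Function.update x j 0))
          have g1 := abs_le.1 (hF (Function.update x j 1))
          have g2 := abs_le.1 (hF (Function.update x j 2))
          rw [abs_le]
          constructor <;> linarith [g0.1, g0.2, g1.1, g1.2, g2.1, g2.2]) S
      rw [integral_const_mul, integral_const_mul] at hD
      rw [Finset.card_insert_of_notMem hj, Finset.sum_insert hj]
      push_cast
      set D1 := ∫ x, (F (Function.update x j 2) - 2 * F (Function.update x j 1) +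
        F (Function.update x j 0)) ∂(Measure.pi (hybrid (poissonMeasure a.toNNReal) b ∅))
      set D2 := ∫ x, (F (Function.update x j 2) - 2 * F (Function.update x j 1) +
        F (Function.update x j 0)) ∂(Measure.pi (hybrid (poissonMeasure a.toNNReal) b S))
      have h2 : 0 ≤ a ^ 2 := by positivity
      have hc : (S.card : ℝ) ≤ Fintype.card ι := by exact_mod_cast Finset.card_le_univ S
      have hD' : |a ^ 2 / 2 * (D1 - D2)| ≤ Fintype.card ι * (14 * a ^ 4) := by
        rw [abs_mul, abs_of_nonneg (by positivity)]
        have : |D1 - D2| ≤ 28 * (Fintype.card ι * a ^ 2) := by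
          have h5 : |D1 - D2| = 4 * |1 / 4 * D1 - 1 / 4 * D2| := by
            rw [← mul_sub, abs_mul, abs_of_pos (by norm_num : (0 : ℝ) < 1 / 4)]; ring
          rw [h5]
          nlinarith
        calc a ^ 2 / 2 * |D1 - D2| ≤ a ^ 2 / 2 * (28 * (Fintype.card ι * a ^ 2)) := by gcongr
          _ = _ := by ring
      rw [abs_le] at ih key hD' ⊢
      constructor <;> linarith [ih.1, ih.2, key.1, key.2, hD'.1, hD'.2]
  have := main Finset.univ
  rwa [hE, hU, Finset.card_univ] at this

/-! ### Laws of the cell counts -/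

theorem cell_subset {n : ℕ} {r : ℕ} (hr : r < n) :
    Set.Ioc ((r : ℝ) / n) (((r : ℝ) + 1) / n) ⊆ Set.Ioc 0 1 := by
  have hn : (0 : ℝ) < n := by exact_mod_cast (by omega : 0 < n)
  apply Set.Ioc_subset_Ioc
  · positivity
  · rw [div_le_one hn]; exact_mod_cast hr

theorem cell_disjoint {n : ℕ} (hn : 0 < n) :
    Pairwise fun i j : Fin n => Disjoint (Set.Ioc ((i : ℝ) / n) (((i : ℝ) + 1) / n))
      (Set.Ioc ((j : ℝ) / n) (((j : ℝ) + 1) / n)) := by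
  intro i j hij
  rw [Set.disjoint_left]
  intro u hi hj
  have hu : 0 < u := (cell_subset i.2 hi).1
  rw [mem_cell_iff hn hu] at hi hj
  exact hij (Fin.ext (hi.symm.trans hj))

theorem volume_cell {n : ℕ} (r : ℝ) :
    volume.real (Set.Ioc (r / n) ((r + 1) / n)) = 1 / n := by
  rw [Real.volume_real_Ioc_of_le (div_le_div_of_nonneg_right (by linarith) (by positivity))]
  ring

namespace IsPoissonProcess

variable {Ω : Type*} [MeasurableSpace Ω] {P : Measure Ω} {lam : ℝ} {X : Ω → Finset ℝ}

theorem measurable_cellCount (hX : IsPoissonProcess lam X P) (n : ℕ) :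
    Measurable fun ω => cellCount n (X ω).val :=
  measurable_pi_lambda _ fun r => hX.measurable_count _ measurableSet_Ioc (cell_subset r.2)

theorem map_cellCount [IsProbabilityMeasure P] (hX : IsPoissonProcess lam X P) {n : ℕ}
    (hn : 0 < n) : P.map (fun ω => cellCount n (X ω).val) =
      Measure.pi fun _ => poissonMeasure (lam / n).toNNReal := by
  have h := (iIndepFun_iff_map_fun_eq_pi_map (fun r : Fin n =>
      (hX.measurable_count _ measurableSet_Ioc (cell_subset r.2)).aemeasurable)).1
    (hX.indep_count n (fun r => Set.Ioc ((r : ℝ) / n) (((r : ℝ) + 1) / n))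
      (fun _ => measurableSet_Ioc) (fun r => cell_subset r.2) (cell_disjoint hn))
  have h2 : ∀ r : Fin n, P.map (fun ω => ptCount (X ω).val
      (Set.Ioc ((r : ℝ) / n) (((r : ℝ) + 1) / n))) = poissonMeasure (lam / n).toNNReal := by
    intro r
    rw [hX.map_count _ measurableSet_Ioc (cell_subset r.2), volume_cell, mul_one_div]
  simp only [h2] at h
  exact h

theorem measureReal_cellCount [IsProbabilityMeasure P] (hX : IsPoissonProcess lam X P) {n : ℕ}
    (hn : 0 < n) (G : (Fin n → ℕ) → Prop) :
    P.real {ω | G (cellCount n (X ω).val)} =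
      (Measure.pi fun _ => poissonMeasure (lam / n).toNNReal).real {x | G x} := by
  rw [← hX.map_cellCount hn, map_measureReal_apply (hX.measurable_cellCount n) .of_discrete]
  rfl

theorem measureReal_cellCount_one_eq [IsProbabilityMeasure P] (hX : IsPoissonProcess lam X P)
    (hlam : 0 ≤ lam) {n : ℕ} (hn : 0 < n) (j : Fin n) (G : (Fin n → ℕ) → Prop) :
    P.real {ω | cellCount n (X ω).val j = 1 ∧ G (cellCount n (X ω).val)} =
      lam / n * P.real {ω | cellCount n (X ω).val j = 0 ∧
        G (cellCount n (X ω).val + Pi.single j 1)} := by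
  have ha : 0 ≤ lam / n := by positivity
  have e1 := hX.measureReal_cellCount hn (fun x => x j = 1 ∧ G x)
  have e0 := hX.measureReal_cellCount hn (fun x => x j = 0 ∧ G (x + Pi.single j 1))
  beta_reduce at e0 e1
  rw [e1, e0]
  refine measureReal_pi_one_eq _ j ?_ G
  rw [poisson_real_one ha, poisson_real_zero ha]

theorem measureReal_forall_cellCount_mem [IsProbabilityMeasure P]
    (hX : IsPoissonProcess lam X P) {n : ℕ} (hn : 0 < n) (S : Finset (Fin n))
    (B : Fin n → Set ℕ) :
    P.real {ω | ∀ j ∈ S, cellCount n (X ω).val j ∈ B j} =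
      ∏ j ∈ S, (poissonMeasure (lam / n).toNNReal).real (B j) := by
  rw [hX.measureReal_cellCount hn (fun x => ∀ j ∈ S, x j ∈ B j)]
  exact measureReal_pi_forall_mem _ S B

theorem measureReal_ptCount_pos_le [IsProbabilityMeasure P] (hX : IsPoissonProcess lam X P)
    (hlam : 0 ≤ lam) {B : Set ℝ} (hB : MeasurableSet B) (hB' : B ⊆ Set.Ioc 0 1) :
    P.real {ω | 1 ≤ ptCount (X ω).val B} ≤ lam * volume.real B := by
  have h := poisson_real_pos_le (a := lam * volume.real B) (by positivity)
  rw [← hX.map_count B hB hB',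
    map_measureReal_apply (hX.measurable_count B hB hB') .of_discrete] at h
  exact h

theorem measureReal_ptCount_pos_and_le [IsProbabilityMeasure P] (hX : IsPoissonProcess lam X P)
    (hlam : 0 ≤ lam) {B C : Set ℝ} (hB : MeasurableSet B) (hB' : B ⊆ Set.Ioc 0 1)
    (hC : MeasurableSet C) (hC' : C ⊆ Set.Ioc 0 1) (hBC : Disjoint B C) :
    P.real {ω | 1 ≤ ptCount (X ω).val B ∧ 1 ≤ ptCount (X ω).val C} ≤
      (lam * volume.real B) * (lam * volume.real C) := by
  have hi := hX.indep_count 2 ![B, C] (by intro i; fin_cases i <;> simpa)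
    (by intro i; fin_cases i <;> simpa) (by
      intro i j hij
      fin_cases i <;> fin_cases j <;> simp_all [disjoint_comm])
  have h2 : IndepFun (fun ω => ptCount (X ω).val B) (fun ω => ptCount (X ω).val C) P :=
    hi.indepFun (i := 0) (j := 1) (by simp)
  have h3 := h2.measure_inter_preimage_eq_mul {y | 1 ≤ y} {y | 1 ≤ y} .of_discrete .of_discrete
  have h4 : P.real {ω | 1 ≤ ptCount (X ω).val B ∧ 1 ≤ ptCount (X ω).val C} =
      P.real {ω | 1 ≤ ptCount (X ω).val B} * P.real {ω | 1 ≤ ptCount (X ω).val C} := by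
    rw [measureReal_def, measureReal_def, measureReal_def, ← ENNReal.toReal_mul]
    exact congrArg _ h3
  rw [h4]
  have := hX.measureReal_ptCount_pos_le hlam hB hB'
  have := hX.measureReal_ptCount_pos_le hlam hC hC'
  gcongr

theorem integrable_card [IsProbabilityMeasure P] (hX : IsPoissonProcess lam X P) :
    Integrable (fun ω => ((X ω).card : ℝ)) P := by
  have h1 : ∀ ω, (X ω).card = ptCount (X ω).val (Set.Ioc 0 1) := fun ω =>
    (ptCount_eq_card fun x hx => hX.subset ω hx).symm
  simp only [h1]
  have hm := hX.measurable_count _ measurableSet_Ioc subset_rfl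
  have := integrable_natCast_poisson (lam * volume.real (Set.Ioc (0 : ℝ) 1)).toNNReal
  rw [← hX.map_count _ measurableSet_Ioc subset_rfl] at this
  exact this.comp_measurable hm

theorem ae_notMem [IsProbabilityMeasure P] (hX : IsPoissonProcess lam X P) (hlam : 0 ≤ lam)
    (c : ℝ) : ∀ᵐ ω ∂P, c ∉ X ω := by
  by_cases hc : c ∈ Set.Ioc (0 : ℝ) 1
  · have h := hX.measureReal_ptCount_pos_le hlam (measurableSet_singleton c)
      (Set.singleton_subset_iff.2 hc)
    simp only [Measure.real, Real.volume_singleton, ENNReal.toReal_zero, mul_zero] at h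
    have h0 : P {ω | 1 ≤ ptCount (X ω).val {c}} = 0 := by
      have := le_antisymm h ENNReal.toReal_nonneg
      rwa [ENNReal.toReal_eq_zero_iff, or_iff_left (measure_ne_top _ _)] at this
    refine measure_mono_null (fun ω hω => ?_) h0
    have hω' : c ∈ X ω := by simpa using hω
    exact Nat.succ_le_of_lt (ptCount_pos.2 ⟨c, hω', rfl⟩)
  · exact Eventually.of_forall fun ω h => hc (hX.subset ω h)

/-- Almost surely, no two points of the process are at a given distance. -/
theorem ae_add_notMem [IsProbabilityMeasure P] (hX : IsPoissonProcess lam X P) (hlam : 0 ≤ lam)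
    {c : ℝ} (hc : 0 < c) : ∀ᵐ ω ∂P, ∀ x ∈ X ω, x + c ∉ X ω := by
  -- If `x` and `x + c` are both points, then some cell and its translate by `c` are both occupied.
  -- For `n * c ≥ 1` the two are disjoint, so each of the `n` pairs has probability at most `(lam /
  -- n)²`.
  have hbound : ∀ n : ℕ, 0 < n → 1 ≤ n * c →
      P.real {ω | ¬ ∀ x ∈ X ω, x + c ∉ X ω} ≤ lam ^ 2 * (1 / (n : ℝ)) := by
    intro n hn hnc
    have hn' : (0 : ℝ) < n := by exact_mod_cast hn
    set B : Fin n → Set ℝ := fun r => Set.Ioc ((r : ℝ) / n) (((r : ℝ) + 1) / n)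
    set C : Fin n → Set ℝ := fun r => Set.Ioc ((r : ℝ) / n + c) (((r : ℝ) + 1) / n + c) ∩
      Set.Ioc 0 1
    have hsub : {ω | ¬ ∀ x ∈ X ω, x + c ∉ X ω} ⊆
        ⋃ r : Fin n, {ω | 1 ≤ ptCount (X ω).val (B r) ∧ 1 ≤ ptCount (X ω).val (C r)} := by
      intro ω hω
      have hω' : ∃ x ∈ X ω, x + c ∈ X ω := by simpa using hω
      obtain ⟨x, hx, hxc⟩ := hω'
      have hx1 := hX.subset ω hx
      have hcell := (mem_cell_iff hn hx1.1 _).2 rfl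
      rw [Set.mem_iUnion]
      refine ⟨⟨cellIndex n x, cellIndex_lt hn hx1.1 hx1.2⟩,
        Nat.succ_le_of_lt (ptCount_pos.2 ⟨x, hx, hcell⟩),
        Nat.succ_le_of_lt (ptCount_pos.2 ⟨x + c, hxc, ⟨?_, ?_⟩, hX.subset ω hxc⟩)⟩
      · have := hcell.1
        simpa using this
      · have := hcell.2
        simpa using this
    refine (measureReal_mono hsub).trans ((measureReal_iUnion_fintype_le _).trans ?_)
    have hr : ∀ r : Fin n, P.real {ω | 1 ≤ ptCount (X ω).val (B r) ∧
        1 ≤ ptCount (X ω).val (C r)} ≤ (lam * (1 / n)) * (lam * (1 / n)) := by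
      intro r
      refine (hX.measureReal_ptCount_pos_and_le hlam measurableSet_Ioc (cell_subset r.2)
        (measurableSet_Ioc.inter measurableSet_Ioc) Set.inter_subset_right ?_).trans ?_
      · rw [Set.disjoint_left]
        intro u hu hu'
        have h1 := hu.2
        have h2 := hu'.1.1
        have h3 : ((r : ℝ) + 1) / n ≤ r / n + c := by
          rw [add_div]
          gcongr
          rw [div_le_iff₀ hn']
          linarith
        linarith
      · have h1 : volume.real (B r) = 1 / n := volume_cell _
        have h2 : volume.real (C r) ≤ 1 / n := by
          refine (measureReal_mono Set.inter_subset_left (by simp)).trans ?_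
          rw [Real.volume_real_Ioc_of_le]
          · apply le_of_eq; ring
          · gcongr; linarith
        rw [h1]
        gcongr
    refine (Finset.sum_le_sum fun r _ => hr r).trans ?_
    rw [Finset.sum_const, Finset.card_univ, Fintype.card_fin, nsmul_eq_mul]
    apply le_of_eq
    field_simp
  have hlim : Tendsto (fun n : ℕ => lam ^ 2 * (1 / (n : ℝ))) atTop (𝓝 (lam ^ 2 * 0)) :=
    tendsto_one_div_atTop_nhds_zero_nat.const_mul _
  have hle : P.real {ω | ¬ ∀ x ∈ X ω, x + c ∉ X ω} ≤ lam ^ 2 * 0 := by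
    refine ge_of_tendsto hlim ?_
    filter_upwards [eventually_gt_atTop 0,
      (tendsto_natCast_atTop_atTop.atTop_mul_const hc).eventually_ge_atTop 1] with n h1 h2
    exact hbound n h1 h2
  rw [mul_zero] at hle
  have := le_antisymm hle measureReal_nonneg
  rwa [measureReal_eq_zero_iff] at this

end IsPoissonProcess

/-! ### The law of a Bernoulli sequence -/

theorem eq_of_bernoulli {b c : Measure ℕ} [IsProbabilityMeasure b] [IsProbabilityMeasure c]
    {a : ℝ} (hb0 : b.real {0} = 1 - a) (hb1 : b.real {1} = a) (hc0 : c.real {0} = 1 - a)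
    (hc1 : c.real {1} = a) : b = c := by
  ext s hs
  have hh : ∀ y, |s.indicator (1 : ℕ → ℝ) y| ≤ 1 := by
    intro y
    by_cases hy : y ∈ s <;> simp [hy]
  have h1 := integral_bernoulli b hb0 hb1 hh
  rw [← integral_bernoulli c hc0 hc1 hh, integral_indicator_one hs, integral_indicator_one hs] at h1
  rwa [measureReal_def, measureReal_def, ENNReal.toReal_eq_toReal_iff' (measure_ne_top _ _)
    (measure_ne_top _ _)] at h1

theorem IsBernoulliSeq.exists_map_eq {Ω : Type*} [MeasurableSpace Ω] {P : Measure Ω}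
    [IsProbabilityMeasure P] {n : ℕ} (hn : 0 < n) {a : ℝ} {H : Fin n → Ω → ℕ}
    (hH : IsBernoulliSeq a H P) :
    ∃ b : Measure ℕ, IsProbabilityMeasure b ∧ b.real {0} = 1 - a ∧ b.real {1} = a ∧
      P.map (fun ω r => H r ω) = Measure.pi fun _ => b := by
  have hp : ∀ r, IsProbabilityMeasure (P.map (H r)) := fun r =>
    Measure.isProbabilityMeasure_map (hH.measurable r).aemeasurable
  have h0 : ∀ r, (P.map (H r)).real {0} = 1 - a := fun r => by
    rw [map_measureReal_apply (hH.measurable r) .of_discrete]; exact hH.prob_zero r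
  have h1 : ∀ r, (P.map (H r)).real {1} = a := fun r => by
    rw [map_measureReal_apply (hH.measurable r) .of_discrete]; exact hH.prob_one r
  refine ⟨P.map (H ⟨0, hn⟩), hp _, h0 _, h1 _, ?_⟩
  rw [(iIndepFun_iff_map_fun_eq_pi_map fun r => (hH.measurable r).aemeasurable).1 hH.indep]
  congr 1
  ext1 r
  exact eq_of_bernoulli (h0 _) (h1 _) (h0 _) (h1 _)

/-! ### Sums over cells and sums over points -/

theorem sum_cellCount (n : ℕ) (s : Finset ℝ) (hs : ∀ x ∈ s, x ∈ Set.Ioc (0 : ℝ) 1) (hn : 0 < n) :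
    ∑ j, cellCount n s.val j = s.card := by
  have h := windowSum_cellCount (n := n) 0 n (by omega) s.val
  have hn' : (n : ℝ) ≠ 0 := by exact_mod_cast hn.ne'
  have h2 : windowSum 0 n (cellCount n s.val) = ∑ j, cellCount n s.val j := by
    unfold windowSum
    congr 1
    ext j
    simp
  rw [← h2, h]
  refine ptCount_eq_card fun x hx => ?_
  have := hs x hx
  simpa [hn'] using this

theorem ptCount_eq_countP {s : Multiset ℝ} {B : Set ℝ} {p : ℝ → Prop} [DecidablePred p]
    (h : ∀ x ∈ s, (x ∈ B ↔ p x)) : ptCount s B = s.countP p := by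
  classical
  exact Multiset.countP_congr rfl fun x hx => propext (h x hx)

theorem cellCount_eq_card {n : ℕ} (hn : 0 < n) {s : Finset ℝ}
    (hs : ∀ x ∈ s, x ∈ Set.Ioc (0 : ℝ) 1) (j : Fin n) :
    cellCount n s.val j = {x ∈ s | cellIndex n x = j}.card := by
  exact (ptCount_eq_countP fun x hx => mem_cell_iff hn (hs x hx).1 j).trans
    (Multiset.countP_eq_card_filter _ _)

theorem cellCount_le_one {n : ℕ} (hn : 0 < n) {s : Finset ℝ}
    (hs : ∀ x ∈ s, x ∈ Set.Ioc (0 : ℝ) 1) (hinj : Set.InjOn (cellIndex n) s) (j : Fin n) :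
    cellCount n s.val j ≤ 1 := by
  rw [cellCount_eq_card hn hs, Finset.card_le_one]
  intro x hx y hy
  rw [Finset.mem_filter] at hx hy
  exact hinj hx.1 hy.1 (hx.2.trans hy.2.symm)

/-- Once the mesh separates the points, singly occupied cells correspond bijectively to points, so
sums over cells become sums over the process. -/
theorem sum_cellCount_eq_one {n : ℕ} (hn : 0 < n) {s : Finset ℝ}
    (hs : ∀ x ∈ s, x ∈ Set.Ioc (0 : ℝ) 1) (hinj : Set.InjOn (cellIndex n) s) (g : Fin n → ℝ) :
    ∑ j, (if cellCount n s.val j = 1 then g j else 0) =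
      ∑ x ∈ s, if h : cellIndex n x < n then g ⟨cellIndex n x, h⟩ else 0 := by
  have h1 : ∀ j, (if cellCount n s.val j = 1 then g j else 0) =
      ∑ x ∈ s, if cellIndex n x = (j : ℕ) then g j else 0 := by
    intro j
    rw [← Finset.sum_filter, Finset.sum_const, ← cellCount_eq_card hn hs, nsmul_eq_mul]
    have := cellCount_le_one hn hs hinj j
    split_ifs with h
    · simp [h]
    · have : cellCount n s.val j = 0 := by omega
      simp [this]
  simp only [h1]
  rw [Finset.sum_comm]
  refine Finset.sum_congr rfl fun x hx => ?_
  have hlt := cellIndex_lt hn (hs x hx).1 (hs x hx).2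
  rw [dif_pos hlt, Finset.sum_eq_single ⟨cellIndex n x, hlt⟩]
  · simp
  · intro b _ hb
    rw [if_neg]
    intro h
    exact hb (Fin.ext h.symm)
  · simp

theorem eventually_cellIndex_ne {x y : ℝ} (hx : 0 < x) (hy : 0 < y) (hxy : x ≠ y) :
    ∀ᶠ n : ℕ in atTop, cellIndex n x ≠ cellIndex n y := by
  have hlim : Tendsto (fun n : ℕ => (n : ℝ) * |x - y|) atTop atTop :=
    tendsto_natCast_atTop_atTop.atTop_mul_const (abs_pos.2 (sub_ne_zero.2 hxy))
  filter_upwards [hlim.eventually_ge_atTop 1, eventually_gt_atTop 0] with n hn hn0 h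
  have h1 := cellIndex_lt_mul hn0 hx
  have h2 := mul_le_cellIndex_add_one n x
  have h3 := cellIndex_lt_mul hn0 hy
  have h4 := mul_le_cellIndex_add_one n y
  rw [h] at h1 h2
  rcases abs_cases (x - y) with ⟨h5, _⟩ | ⟨h5, _⟩ <;> rw [h5] at hn <;> nlinarith

theorem eventually_injOn_cellIndex {s : Finset ℝ} (hs : ∀ x ∈ s, x ∈ Set.Ioc (0 : ℝ) 1) :
    ∀ᶠ n : ℕ in atTop, Set.InjOn (cellIndex n) s := by
  have h : ∀ᶠ n : ℕ in atTop, ∀ x ∈ s, ∀ y ∈ s, x ≠ y → cellIndex n x ≠ cellIndex n y := by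
    rw [eventually_all_finset]
    intro x hx
    rw [eventually_all_finset]
    intro y hy
    by_cases hxy : x = y
    · exact Eventually.of_forall fun n h => absurd hxy h
    · filter_upwards [eventually_cellIndex_ne (hs x hx).1 (hs y hy).1 hxy] with n hn _ using hn
  filter_upwards [h] with n hn x hx y hy hxy
  by_contra hne
  exact hn x hx y hy hne hxy

theorem tendsto_mul_atTop {q : ℕ} (hq : 0 < q) : Tendsto (fun m : ℕ => m * q) atTop atTop :=
  tendsto_id.atTop_mul_const' hq

/-! ### Integrals of functions that are constant on cells -/

theorem measurable_cellIndex (n : ℕ) : Measurable (cellIndex n) := by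
  unfold cellIndex
  exact (Measurable.of_discrete (f := fun j : ℕ => j - 1)).comp
    (Nat.measurable_ceil.comp (measurable_const_mul _))

theorem integral_comp_cellIndex {n : ℕ} (hn : 0 < n) (g : ℕ → ℝ) :
    ∫ u in (0 : ℝ)..1, g (cellIndex n u) = 1 / n * ∑ j ∈ Finset.range n, g j := by
  have hn' : (n : ℝ) ≠ 0 := by exact_mod_cast hn.ne'
  have hle : ∀ j : ℕ, (j : ℝ) / n ≤ ((j + 1 : ℕ) : ℝ) / n := fun j => by gcongr; omega
  have hEq : ∀ j : ℕ, Set.EqOn (fun _ => g j) (fun u => g (cellIndex n u))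
      (Set.uIoc ((j : ℝ) / n) (((j + 1 : ℕ) : ℝ) / n)) := by
    intro j u hu
    rw [Set.uIoc_of_le (hle j)] at hu
    have hu0 : 0 < u := lt_of_le_of_lt (by positivity) hu.1
    rw [Nat.cast_add_one, mem_cell_iff hn hu0] at hu
    simp only [hu]
  have h := intervalIntegral.sum_integral_adjacent_intervals (μ := volume)
    (f := fun u => g (cellIndex n u)) (a := fun j : ℕ => (j : ℝ) / n) (n := n) (by
      intro j _
      exact (intervalIntegrable_congr (hEq j)).1 intervalIntegrable_const)
  simp only [Nat.cast_zero, zero_div, div_self hn'] at h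
  rw [← h, Finset.mul_sum]
  refine Finset.sum_congr rfl fun j _ => ?_
  rw [← intervalIntegral.integral_congr_ae (Eventually.of_forall fun u hu => hEq j hu),
    intervalIntegral.integral_const]
  push_cast
  rw [smul_eq_mul]
  ring

/-! ### Limits of cell probabilities and cell functionals of the Poisson process -/

namespace IsPoissonProcess

variable {Ω : Type*} [MeasurableSpace Ω] {P : Measure Ω} {lam : ℝ} {X : Ω → Finset ℝ}

theorem measurableSet_cellCount (hX : IsPoissonProcess lam X P) (n : ℕ)
    (G : (Fin n → ℕ) → Prop) : MeasurableSet {ω | G (cellCount n (X ω).val)} :=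
  hX.measurable_cellCount n (MeasurableSet.of_discrete (s := {x | G x}))

/-- For every outcome the discrete and continuous events agree once the mesh is fine enough. Only
the discrete events, which depend on cell counts, need a direct proof of measurability. -/
theorem tendsto_measureReal_discreteScan [IsProbabilityMeasure P] (hX : IsPoissonProcess lam X P)
    {p q k : ℕ} (hk : 0 < k) (hpq : p < q) {w : ℝ} (hw : w = (p : ℝ) / q) :
    Tendsto (fun m : ℕ => P.real {ω | k ≤ discreteScan (m * p) (cellCount (m * q) (X ω).val)})
      atTop (𝓝 (P.real {ω | k ≤ scanStat w (X ω).val})) := by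
  refine (ENNReal.tendsto_toReal (measure_ne_top _ _)).comp ?_
  exact tendsto_measure_of_tendsto_indicator_of_isFiniteMeasure atTop P
    (fun m => hX.measurableSet_cellCount _ (fun x => k ≤ discreteScan (m * p) x))
    (fun ω => eventually_le_discreteScan_iff hk hpq hw (hX.subset ω))

/-- The probability that the discrete scan reaches `k` after adding a point in cell `j`. -/
def bumpProb (P : Measure Ω) (X : Ω → Finset ℝ) (k L n j : ℕ) : ℝ :=
  if h : j < n then P.real {ω | k ≤ discreteScan L (cellCount n (X ω).val + Pi.single ⟨j, h⟩ 1)}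
  else 0

theorem bumpProb_cellIndex {k L n : ℕ} (hn : 0 < n) {u : ℝ} (hu : u ∈ Set.Ioc (0 : ℝ) 1) :
    bumpProb P X k L n (cellIndex n u) =
      P.real {ω | k ≤ discreteScan L (cellCount n (u ::ₘ (X ω).val))} := by
  rw [bumpProb, dif_pos (cellIndex_lt hn hu.1 hu.2)]
  simp only [cellCount_cons hn hu.1 hu.2]

theorem measurableSet_discreteScan_cons (hX : IsPoissonProcess lam X P) {k L n : ℕ} (hn : 0 < n)
    {u : ℝ} (hu : u ∈ Set.Ioc (0 : ℝ) 1) :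
    MeasurableSet {ω | k ≤ discreteScan L (cellCount n (u ::ₘ (X ω).val))} := by
  obtain ⟨e, he⟩ : ∃ e : Fin n → ℕ, ∀ s, cellCount n (u ::ₘ s) = cellCount n s + e :=
    ⟨_, cellCount_cons hn hu.1 hu.2⟩
  simp only [he]
  exact hX.measurableSet_cellCount n (fun x => k ≤ discreteScan L (x + e))

theorem tendsto_bumpProb [IsProbabilityMeasure P] (hX : IsPoissonProcess lam X P)
    {p q k : ℕ} (hk : 0 < k) (hpq : p < q) {w : ℝ} (hw : w = (p : ℝ) / q) {u : ℝ}
    (hu : u ∈ Set.Ioc (0 : ℝ) 1) :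
    Tendsto (fun m : ℕ => bumpProb P X k (m * p) (m * q) (cellIndex (m * q) u))
      atTop (𝓝 (P.real {ω | k ≤ scanStat w (u ::ₘ (X ω).val)})) := by
  -- The index is shifted by one because at `m = 0` there are no cells to put `u` into.
  have hn : ∀ m : ℕ, 0 < (m + 1) * q := fun m => Nat.mul_pos (by omega) (by omega)
  have h : Tendsto (fun m : ℕ => P.real {ω | k ≤ discreteScan ((m + 1) * p)
      (cellCount ((m + 1) * q) (u ::ₘ (X ω).val))})
      atTop (𝓝 (P.real {ω | k ≤ scanStat w (u ::ₘ (X ω).val)})) := by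
    refine (ENNReal.tendsto_toReal (measure_ne_top _ _)).comp ?_
    refine tendsto_measure_of_tendsto_indicator_of_isFiniteMeasure atTop P
      (fun m => ?_) (fun ω => ?_)
    · exact hX.measurableSet_discreteScan_cons (hn m) hu
    · refine (tendsto_add_atTop_nat 1).eventually (eventually_le_discreteScan_iff hk hpq hw ?_)
      intro x hx
      rcases Multiset.mem_cons.1 hx with rfl | hx
      · exact hu
      · exact hX.subset ω hx
  rw [← tendsto_add_atTop_iff_nat 1]
  refine h.congr fun m => (bumpProb_cellIndex (hn m) hu).symm

theorem abs_bumpProb_le [IsProbabilityMeasure P] (k L n j : ℕ) : |bumpProb P X k L n j| ≤ 1 := by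
  unfold bumpProb
  split_ifs
  · rw [abs_of_nonneg measureReal_nonneg]; exact measureReal_le_one
  · simp

/-- Measurability in `u` comes from the approximating functions, which are constant on cells; the
values lie in `[0, 1]`. -/
theorem intervalIntegrable_measureReal_scanStat_cons [IsProbabilityMeasure P]
    (hX : IsPoissonProcess lam X P) {p q k : ℕ} (hk : 0 < k) (hpq : p < q) {w : ℝ}
    (hw : w = (p : ℝ) / q) :
    IntervalIntegrable (fun u : ℝ => P.real {ω | k ≤ scanStat w (u ::ₘ (X ω).val)}) volume 0 1 := by
  rw [intervalIntegrable_iff_integrableOn_Ioc_of_le zero_le_one]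
  refine Integrable.of_bound (C := 1) ?_ (Eventually.of_forall fun u => ?_)
  · refine aestronglyMeasurable_of_tendsto_ae atTop
      (f := fun (m : ℕ) u => bumpProb P X k (m * p) (m * q) (cellIndex (m * q) u)) (fun m => ?_) ?_
    · exact ((Measurable.of_discrete (f := bumpProb P X k (m * p) (m * q))).comp
        (measurable_cellIndex _)).aestronglyMeasurable
    · exact (ae_restrict_iff' measurableSet_Ioc).2
        (Eventually.of_forall fun u hu => hX.tendsto_bumpProb hk hpq hw hu)
  · rw [Real.norm_eq_abs, abs_of_nonneg measureReal_nonneg]; exact measureReal_le_one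

/-- The average over cells is exactly the integral of a step function in `u`, and the step functions
converge boundedly. -/
theorem tendsto_sum_bumpProb [IsProbabilityMeasure P]
    (hX : IsPoissonProcess lam X P) {p q k : ℕ} (hk : 0 < k) (hpq : p < q) {w : ℝ}
    (hw : w = (p : ℝ) / q) :
    Tendsto (fun m : ℕ => 1 / ((m * q : ℕ) : ℝ) * ∑ j : Fin (m * q),
        P.real {ω | k ≤ discreteScan (m * p) (cellCount (m * q) (X ω).val + Pi.single j 1)})
      atTop (𝓝 (∫ u in (0 : ℝ)..1, P.real {ω | k ≤ scanStat w (u ::ₘ (X ω).val)})) := by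
  have h : Tendsto (fun m : ℕ => ∫ u in (0 : ℝ)..1,
      bumpProb P X k (m * p) (m * q) (cellIndex (m * q) u)) atTop
      (𝓝 (∫ u in (0 : ℝ)..1, P.real {ω | k ≤ scanStat w (u ::ₘ (X ω).val)})) := by
    refine intervalIntegral.tendsto_integral_filter_of_dominated_convergence (fun _ => 1)
      (Eventually.of_forall fun m => ?_) (Eventually.of_forall fun m => ?_)
      intervalIntegrable_const (Eventually.of_forall fun u hu => ?_)
    · exact ((Measurable.of_discrete (f := bumpProb P X k (m * p) (m * q))).comp
        (measurable_cellIndex _)).aestronglyMeasurable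
    · exact Eventually.of_forall fun u _ => abs_bumpProb_le _ _ _ _
    · rw [Set.uIoc_of_le zero_le_one] at hu
      exact hX.tendsto_bumpProb hk hpq hw hu
  refine h.congr' ?_
  filter_upwards [eventually_gt_atTop 0] with m hm
  rw [integral_comp_cellIndex (Nat.mul_pos hm (by omega)), Finset.sum_range]
  simp [bumpProb]

/-! ### Doubling a point of the process -/

open Classical in
/-- The number of cells with exactly one point whose doubling makes the discrete scan reach `k`. -/
def doubleCount (k L n : ℕ) (x : Fin n → ℕ) : ℝ :=
  ∑ j, if x j = 1 then ((if k ≤ discreteScan L (x + Pi.single j 1) then 1 else 0) -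
    (if k ≤ discreteScan L x then 1 else 0)) else 0

theorem abs_doubleCount_le (k L n : ℕ) (x : Fin n → ℕ) :
    |doubleCount k L n x| ≤ ∑ j, (x j : ℝ) := by
  refine (Finset.abs_sum_le_sum_abs _ _).trans (Finset.sum_le_sum fun j _ => ?_)
  split_ifs with h <;> simp [h]

theorem eventually_doubleCount_eq {p q k : ℕ} (hk : 0 < k) (hpq : p < q) {w : ℝ}
    (hw : w = (p : ℝ) / q) {s : Finset ℝ} (hs : ∀ x ∈ s, x ∈ Set.Ioc (0 : ℝ) 1) :
    ∀ᶠ m : ℕ in atTop,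
      doubleCount k (m * p) (m * q) (cellCount (m * q) s.val) = nuTildeFun w k s := by
  classical
  have hw1 : w ≤ 1 := by
    rw [hw, div_le_one (by exact_mod_cast (by omega : 0 < q))]; exact_mod_cast hpq.le
  have h1 : ∀ᶠ m : ℕ in atTop, ∀ x ∈ s,
      (k ≤ discreteScan (m * p) (cellCount (m * q) (x ::ₘ s.val)) ↔
        k ≤ scanStat w (x ::ₘ s.val)) := by
    rw [eventually_all_finset]
    intro x hx
    refine eventually_le_discreteScan_iff hk hpq hw fun y hy => ?_
    rcases Multiset.mem_cons.1 hy with rfl | hy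
    · exact hs _ hx
    · exact hs _ hy
  filter_upwards [h1, eventually_le_discreteScan_iff hk hpq hw hs, eventually_gt_atTop 0,
    (tendsto_mul_atTop (by omega : 0 < q)).eventually (eventually_injOn_cellIndex hs)]
    with m h1 h2 hm hinj
  have hn : 0 < m * q := Nat.mul_pos hm (by omega)
  rw [doubleCount, sum_cellCount_eq_one hn hs hinj, nuTildeFun, Nat.cast_sum]
  refine Finset.sum_congr rfl fun x hx => ?_
  rw [dif_pos (cellIndex_lt hn (hs x hx).1 (hs x hx).2),
    ← cellCount_cons hn (hs x hx).1 (hs x hx).2]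
  simp only [h1 x hx, h2]
  -- Doubling a point raises the scan by at most one, so reaching `k` from below `k` means being
  -- equal to `k`.
  have h3 := scanStat_cons_le hw1 x s.val
  have h4 := scanStat_le_cons hw1 x s.val
  split_ifs <;> first | omega | norm_num

/-- Dominated convergence, with the total number of points as majorant; measurability of the limit
is inherited from the cell functionals. -/
theorem integrable_nuTildeFun_and_tendsto [IsProbabilityMeasure P]
    (hX : IsPoissonProcess lam X P) {p q k : ℕ} (hk : 0 < k) (hpq : p < q) {w : ℝ}
    (hw : w = (p : ℝ) / q) :
    Integrable (fun ω => (nuTildeFun w k (X ω) : ℝ)) P ∧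
    Tendsto (fun m : ℕ => ∫ ω, doubleCount k (m * p) (m * q) (cellCount (m * q) (X ω).val) ∂P)
      atTop (𝓝 (∫ ω, (nuTildeFun w k (X ω) : ℝ) ∂P)) := by
  have hmeas : ∀ m : ℕ, AEStronglyMeasurable
      (fun ω => doubleCount k (m * p) (m * q) (cellCount (m * q) (X ω).val)) P := fun m =>
    ((Measurable.of_discrete (f := doubleCount k (m * p) (m * q))).comp
      (hX.measurable_cellCount _)).aestronglyMeasurable
  have hlim : ∀ᵐ ω ∂P, Tendsto (fun m : ℕ =>
      doubleCount k (m * p) (m * q) (cellCount (m * q) (X ω).val)) atTop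
      (𝓝 (nuTildeFun w k (X ω) : ℝ)) := Eventually.of_forall fun ω =>
    tendsto_nhds_of_eventually_eq (eventually_doubleCount_eq hk hpq hw (hX.subset ω))
  constructor
  · refine hX.integrable_card.mono' (aestronglyMeasurable_of_tendsto_ae atTop hmeas hlim)
      (Eventually.of_forall fun ω => ?_)
    rw [Real.norm_eq_abs, abs_of_nonneg (by positivity)]
    have : nuTildeFun w k (X ω) ≤ (X ω).card := by
      unfold nuTildeFun
      rw [← Finset.card_filter]
      exact Finset.card_filter_le _ _
    exact_mod_cast this
  · refine tendsto_integral_filter_of_dominated_convergence (fun ω => ((X ω).card : ℝ))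
      (Eventually.of_forall hmeas) ?_ hX.integrable_card hlim
    filter_upwards [eventually_gt_atTop 0] with m hm
    refine Eventually.of_forall fun ω => ?_
    rw [Real.norm_eq_abs]
    refine (abs_doubleCount_le _ _ _ _).trans ?_
    rw [← sum_cellCount (m * q) (X ω) (hX.subset ω) (Nat.mul_pos hm (by omega))]
    push_cast
    exact le_rfl

end IsPoissonProcess

/-! ### From Poisson cells to Bernoulli cells -/

theorem abs_measureReal_sub_le {α : Type*} [MeasurableSpace α] (μ : Measure α) [IsFiniteMeasure μ]
    {A B C : Set α} (h : ∀ x, x ∉ C → (x ∈ A ↔ x ∈ B)) : |μ.real A - μ.real B| ≤ μ.real C := by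
  have h1 : μ.real A ≤ μ.real B + μ.real C :=
    (measureReal_mono fun x hx => by
      by_cases hC : x ∈ C
      · exact Or.inr hC
      · exact Or.inl ((h x hC).1 hx)).trans (measureReal_union_le B C)
  have h2 : μ.real B ≤ μ.real A + μ.real C :=
    (measureReal_mono fun x hx => by
      by_cases hC : x ∈ C
      · exact Or.inr hC
      · exact Or.inl ((h x hC).2 hx)).trans (measureReal_union_le A C)
  rw [abs_le]
  constructor <;> linarith

theorem measureReal_pi_poisson_pos_le {ι : Type*} [Fintype ι] {a : ℝ} (ha : 0 ≤ a) (j : ι) :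
    (Measure.pi fun _ : ι => poissonMeasure a.toNNReal).real {x | 1 ≤ x j} ≤ a := by
  have h := measureReal_pi_forall_mem (fun _ : ι => poissonMeasure a.toNNReal) {j}
    (fun _ => {y | 1 ≤ y})
  simp only [Finset.mem_singleton, forall_eq, Finset.prod_singleton] at h
  exact h.trans_le (poisson_real_pos_le ha)

theorem integral_ite_one {α : Type*} [MeasurableSpace α] [DiscreteMeasurableSpace α]
    (μ : Measure α) (G : α → Prop) [DecidablePred G] :
    ∫ x, (if G x then (1 : ℝ) else 0) ∂μ = μ.real {x | G x} := by
  rw [← integral_indicator_one (MeasurableSet.of_discrete (s := {x | G x}))]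
  refine integral_congr_ae (Eventually.of_forall fun x => ?_)
  by_cases h : G x <;> simp [Set.indicator, h]

theorem integrable_ite_one {α : Type*} [MeasurableSpace α] [DiscreteMeasurableSpace α] [Countable α]
    (μ : Measure α) [IsFiniteMeasure μ] (G : α → Prop) [DecidablePred G] :
    Integrable (fun x => if G x then (1 : ℝ) else 0) μ :=
  integrable_of_abs_le (C := 1) μ fun x => by split_ifs <;> simp

theorem update_one_add_single {ι : Type*} [DecidableEq ι] (x : ι → ℕ) (j : ι) :
    Function.update x j 1 + Pi.single j 1 = Function.update x j 2 := by
  ext i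
  by_cases hi : i = j
  · subst hi; simp
  · simp [hi]

theorem update_zero_eq {ι : Type*} [DecidableEq ι] {x : ι → ℕ} {j : ι} (h : x j = 0) :
    Function.update x j 0 = x := by
  rw [← h, Function.update_eq_self]

theorem update_one_eq {ι : Type*} [DecidableEq ι] {x : ι → ℕ} {j : ι} (h : x j = 0) :
    Function.update x j 1 = x + Pi.single j 1 := by
  ext i
  by_cases hi : i = j
  · subst hi; simp [h]
  · simp [hi]

/-- By independence, requiring coordinate `j` to be `1` contributes the factor `a * exp (-a)` and
fixes it at `1`, and the doubling then turns it into `2`. -/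
theorem integral_doubleCount {k L n : ℕ} {a : ℝ} (ha : 0 ≤ a) :
    ∫ x, IsPoissonProcess.doubleCount k L n x ∂(Measure.pi fun _ => poissonMeasure a.toNNReal) =
      a * Real.exp (-a) * ∑ j : Fin n,
        ((Measure.pi fun _ => poissonMeasure a.toNNReal).real
          {x | k ≤ discreteScan L (Function.update x j 2)} -
        (Measure.pi fun _ => poissonMeasure a.toNNReal).real
          {x | k ≤ discreteScan L (Function.update x j 1)}) := by
  classical
  set ρ : Measure (Fin n → ℕ) := Measure.pi fun _ => poissonMeasure a.toNNReal with hρ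
  unfold IsPoissonProcess.doubleCount
  have hterm : ∀ (x : Fin n → ℕ) (j : Fin n),
      (if x j = 1 then (((if k ≤ discreteScan L (x + Pi.single j 1) then 1 else 0) : ℝ) -
        (if k ≤ discreteScan L x then 1 else 0)) else 0) =
      (if x j = 1 ∧ k ≤ discreteScan L (x + Pi.single j 1) then 1 else 0) -
        (if x j = 1 ∧ k ≤ discreteScan L x then 1 else 0) := by
    intro x j
    by_cases h : x j = 1 <;> simp [h]
  simp only [hterm]
  rw [integral_finsetSum, Finset.mul_sum]
  · refine Finset.sum_congr rfl fun j _ => ?_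
    rw [integral_sub (integrable_ite_one _ _) (integrable_ite_one _ _), integral_ite_one,
      integral_ite_one]
    have e1 := measureReal_pi_eq_and (fun _ : Fin n => poissonMeasure a.toNNReal) j 1
      (fun x => k ≤ discreteScan L (x + Pi.single j 1))
    have e2 := measureReal_pi_eq_and (fun _ : Fin n => poissonMeasure a.toNNReal) j 1
      (fun x => k ≤ discreteScan L x)
    beta_reduce at e1 e2
    simp only [update_one_add_single, poisson_real_one ha] at e1 e2
    rw [hρ, e1, e2]
    ring
  · exact fun j _ => (integrable_ite_one _ _).sub (integrable_ite_one _ _)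

theorem abs_poisson_sub_bernoulli_sub_le {k L n : ℕ} (hn : 0 < n) {lam : ℝ} (hlam : 0 < lam)
    (hle : lam ≤ n) (b : Measure ℕ) [IsProbabilityMeasure b]
    (h0 : b.real {0} = 1 - lam / n) (h1 : b.real {1} = lam / n)
    (ρ : Measure (Fin n → ℕ)) (hρ : ρ = Measure.pi fun _ => poissonMeasure (lam / n).toNNReal) :
    |2 * (n : ℝ) / lam ^ 2 * (ρ.real {x | k ≤ discreteScan L x} -
        (Measure.pi fun _ : Fin n => b).real {x | k ≤ discreteScan L x}) -
      (Real.exp (lam / n) / lam * ∫ x, IsPoissonProcess.doubleCount k L n x ∂ρ +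
        ρ.real {x | k ≤ discreteScan L x} -
        1 / n * ∑ j : Fin n, ρ.real {x | k ≤ discreteScan L (x + Pi.single j 1)})| ≤
      (12 * lam + 28 * lam ^ 2) * (1 / n) := by
  classical
  have hn' : (0 : ℝ) < n := by exact_mod_cast hn
  set a := lam / n with hadef
  have ha : 0 ≤ a := by positivity
  have ha1 : a ≤ 1 := by rw [hadef, div_le_one hn']; exact hle
  have hprob : IsProbabilityMeasure ρ := by rw [hρ]; infer_instance
  have key := abs_integral_pi_poisson_sub_bernoulli_le (ι := Fin n) b ha ha1 h0 h1
    (F := fun x => if k ≤ discreteScan L x then 1 else 0)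
    (fun x => by split_ifs <;> simp)
  rw [← hρ] at key
  set A : ℕ → Fin n → ℝ := fun c j => ρ.real {x | k ≤ discreteScan L (Function.update x j c)}
    with hA
  have hD : ∀ j : Fin n, ∫ x, ((if k ≤ discreteScan L (Function.update x j 2) then (1 : ℝ) else 0) -
      2 * (if k ≤ discreteScan L (Function.update x j 1) then 1 else 0) +
      (if k ≤ discreteScan L (Function.update x j 0) then 1 else 0)) ∂ρ =
      (A 2 j - A 1 j) - A 1 j + A 0 j := by
    intro j
    rw [integral_add, integral_sub, integral_const_mul, integral_ite_one, integral_ite_one,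
      integral_ite_one]
    · ring
    · exact integrable_ite_one _ _
    · exact (integrable_ite_one _ _).const_mul _
    · exact (integrable_ite_one _ _).sub ((integrable_ite_one _ _).const_mul _)
    · exact integrable_ite_one _ _
  simp only [hD, integral_ite_one, Fintype.card_fin] at key
  rw [Finset.sum_add_distrib, Finset.sum_sub_distrib] at key
  have hdc : ∫ x, IsPoissonProcess.doubleCount k L n x ∂ρ =
      a * Real.exp (-a) * ∑ j, (A 2 j - A 1 j) := by
    rw [hρ, integral_doubleCount ha]
    simp only [hA, hρ]
  have hpos : ∀ j, ρ.real {x | 1 ≤ x j} ≤ a := fun j => by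
    rw [hρ]; exact measureReal_pi_poisson_pos_le ha j
  -- Setting coordinate `j` to `0` changes nothing unless that cell is occupied, an event of
  -- probability at most `a`. The same argument compares `A 1` with adding a point.
  have hA0 : ∀ j, |A 0 j - ρ.real {x | k ≤ discreteScan L x}| ≤ a := fun j =>
    (abs_measureReal_sub_le ρ (C := {x | 1 ≤ x j}) fun x hx => by
      have hx0 : x j = 0 := by simpa using hx
      simp only [Set.mem_ofPred_eq, update_zero_eq hx0]).trans (hpos j)
  have hA1 : ∀ j, |A 1 j - ρ.real {x | k ≤ discreteScan L (x + Pi.single j 1)}| ≤ a := fun j =>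
    (abs_measureReal_sub_le ρ (C := {x | 1 ≤ x j}) fun x hx => by
      have hx0 : x j = 0 := by simpa using hx
      simp only [Set.mem_ofPred_eq, update_one_eq hx0]).trans (hpos j)
  have havg : ∀ f g : Fin n → ℝ, (∀ j, |f j - g j| ≤ a) →
      |1 / n * ∑ j, f j - 1 / n * ∑ j, g j| ≤ a := by
    intro f g hfg
    rw [← mul_sub, ← Finset.sum_sub_distrib, abs_mul, abs_of_nonneg (by positivity)]
    have : |∑ j, (f j - g j)| ≤ n * a := by
      refine (Finset.abs_sum_le_sum_abs _ _).trans ((Finset.sum_le_sum fun j _ => hfg j).trans ?_)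
      simp
    calc 1 / (n : ℝ) * |∑ j, (f j - g j)| ≤ 1 / n * (n * a) := by gcongr
      _ = a := by field_simp
  have hA0' := havg _ _ hA0
  have hA1' := havg _ _ hA1
  rw [Finset.sum_const, Finset.card_univ, Fintype.card_fin, nsmul_eq_mul, ← mul_assoc,
    one_div_mul_cancel hn'.ne', one_mul] at hA0'
  have hdc' : Real.exp a / lam * ∫ x, IsPoissonProcess.doubleCount k L n x ∂ρ =
      1 / n * ∑ j, (A 2 j - A 1 j) := by
    rw [hdc, Real.exp_neg, hadef]
    have := Real.exp_pos (lam / n)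
    field_simp
  rw [hdc']
  -- The factor `2n / lam²` turns `a² / 2` into `1 / n` and the error `n * (5 a³ + 14 n a⁴)` into
  -- `(10 lam + 28 lam²) / n`. The comparisons of `A 0` and `A 1` later add `2 lam / n`.
  have hkey2 : |2 * (n : ℝ) / lam ^ 2 * (ρ.real {x | k ≤ discreteScan L x} -
        (Measure.pi fun _ : Fin n => b).real {x | k ≤ discreteScan L x}) -
      (1 / n * ∑ j, (A 2 j - A 1 j) - 1 / n * ∑ j, A 1 j + 1 / n * ∑ j, A 0 j)| ≤
      (10 * lam + 28 * lam ^ 2) * (1 / n) := by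
    have hc : 0 ≤ 2 * (n : ℝ) / lam ^ 2 := by positivity
    have := mul_le_mul_of_nonneg_left key hc
    rw [← abs_of_nonneg hc, ← abs_mul, abs_of_nonneg hc] at this
    have e1 : 2 * (n : ℝ) / lam ^ 2 * (ρ.real {x | k ≤ discreteScan L x} -
        (Measure.pi fun _ : Fin n => b).real {x | k ≤ discreteScan L x} -
        a ^ 2 / 2 * (∑ j, (A 2 j - A 1 j) - ∑ j, A 1 j + ∑ j, A 0 j)) =
        2 * (n : ℝ) / lam ^ 2 * (ρ.real {x | k ≤ discreteScan L x} -
        (Measure.pi fun _ : Fin n => b).real {x | k ≤ discreteScan L x}) -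
      (1 / n * ∑ j, (A 2 j - A 1 j) - 1 / n * ∑ j, A 1 j + 1 / n * ∑ j, A 0 j) := by
      rw [hadef]; field_simp
    rw [e1] at this
    refine this.trans (le_of_eq ?_)
    rw [hadef]
    field_simp
    ring
  have ha' : a = lam * (1 / n) := by rw [hadef]; ring
  rw [abs_le] at *
  rw [ha'] at hA0' hA1'
  constructor <;> linarith [hkey2.1, hkey2.2, hA0'.1, hA0'.2, hA1'.1, hA1'.2]

theorem IsPoissonProcess.tendsto_discrete_sub_bernoulli {Ω : Type*} [MeasurableSpace Ω]
    {P : Measure Ω} [IsProbabilityMeasure P] {lam : ℝ} (hlam : 0 < lam) {p q k : ℕ} (hpq : p < q)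
    (hk : 0 < k) {w : ℝ} (hw : w = (p : ℝ) / q) {X : Ω → Finset ℝ}
    (hX : IsPoissonProcess lam X P) {Ω' : ℕ → Type*} [∀ m, MeasurableSpace (Ω' m)]
    (P' : ∀ m, Measure (Ω' m)) [∀ m, IsProbabilityMeasure (P' m)]
    (H : ∀ m : ℕ, Fin (m * q) → Ω' m → ℕ)
    (hH : ∀ m : ℕ, lam ≤ (m : ℝ) * q → IsBernoulliSeq (lam / ((m : ℝ) * q)) (H m) (P' m)) :
    Tendsto (fun m : ℕ => 2 * ((m : ℝ) * q) / lam ^ 2 *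
        (P.real {ω | k ≤ discreteScan (m * p) (cellCount (m * q) (X ω).val)} -
          (P' m).real {ω | k ≤ discreteScan (m * p) (fun r => H m r ω)})) atTop
      (𝓝 (1 / lam * (∫ ω, (nuTildeFun w k (X ω) : ℝ) ∂P) +
        P.real {ω | k ≤ scanStat w (X ω).val} -
        ∫ u in (0 : ℝ)..1, P.real {ω | k ≤ scanStat w (u ::ₘ (X ω).val)})) := by
  have hq : 0 < q := by omega
  have hq' : (0 : ℝ) < q := by exact_mod_cast hq
  have hinv : Tendsto (fun m : ℕ => 1 / ((m * q : ℕ) : ℝ)) atTop (𝓝 0) :=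
    tendsto_one_div_atTop_nhds_zero_nat.comp (tendsto_mul_atTop hq)
  have hexp : Tendsto (fun m : ℕ => Real.exp (lam / ((m * q : ℕ) : ℝ)) / lam) atTop
      (𝓝 (1 / lam)) := by
    have h1 : Tendsto (fun m : ℕ => lam * (1 / ((m * q : ℕ) : ℝ))) atTop (𝓝 0) := by
      simpa using hinv.const_mul lam
    have h2 := ((Real.continuous_exp.tendsto 0).comp h1).div_const lam
    rw [Real.exp_zero] at h2
    refine h2.congr fun m => ?_
    rw [Function.comp_apply, mul_one_div]
  have hmain := ((hexp.mul (hX.integrable_nuTildeFun_and_tendsto hk hpq hw).2).add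
    (hX.tendsto_measureReal_discreteScan hk hpq hw)).sub (hX.tendsto_sum_bumpProb hk hpq hw)
  have herr : Tendsto (fun m : ℕ => (12 * lam + 28 * lam ^ 2) * (1 / ((m * q : ℕ) : ℝ))) atTop
      (𝓝 0) := by simpa using hinv.const_mul (12 * lam + 28 * lam ^ 2)
  refine tendsto_of_tendsto_of_dist hmain (squeeze_zero' (Eventually.of_forall fun _ => dist_nonneg)
    ?_ herr)
  have hbig : ∀ᶠ m : ℕ in atTop, lam ≤ (m : ℝ) * q :=
    (tendsto_natCast_atTop_atTop.atTop_mul_const hq').eventually_ge_atTop lam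
  filter_upwards [hbig, eventually_gt_atTop 0] with m hm hm0
  have hn : 0 < m * q := Nat.mul_pos hm0 hq
  have hB := hH m hm
  rw [← Nat.cast_mul] at hm hB ⊢
  obtain ⟨b, hb, hb0, hb1, hmap⟩ := hB.exists_map_eq hn
  have hmeasH : Measurable fun ω r => H m r ω := measurable_pi_lambda _ hB.measurable
  have hβ : (P' m).real {ω | k ≤ discreteScan (m * p) (fun r => H m r ω)} =
      (Measure.pi fun _ : Fin (m * q) => b).real {x | k ≤ discreteScan (m * p) x} := by
    rw [← hmap, map_measureReal_apply hmeasH .of_discrete]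
    rfl
  have key := abs_poisson_sub_bernoulli_sub_le (k := k) (L := m * p) hn hlam hm b hb0 hb1 _ rfl
  rw [← hX.map_cellCount hn] at key
  rw [hβ, dist_comm, Real.dist_eq]
  rw [integral_map (hX.measurable_cellCount _).aemeasurable
    (Measurable.of_discrete).aestronglyMeasurable] at key
  simp only [map_measureReal_apply (hX.measurable_cellCount _) MeasurableSet.of_discrete] at key
  exact key

/-! ### Pairs of points at distance close to the window length -/

theorem cellIndex_lt_iff {n : ℕ} (hn : 0 < n) {x y : ℝ}
    (h : cellIndex n x ≠ cellIndex n y) : cellIndex n x < cellIndex n y ↔ x < y := by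
  have hn' : (0 : ℝ) < n := by exact_mod_cast hn
  have mono : ∀ x y : ℝ, x ≤ y → cellIndex n x ≤ cellIndex n y := fun x y hxy =>
    Nat.sub_le_sub_right (Nat.ceil_mono (mul_le_mul_of_nonneg_left hxy hn'.le)) 1
  constructor
  · intro h1
    by_contra h2
    exact absurd (mono _ _ (not_lt.1 h2)) (by omega)
  · intro h1
    exact lt_of_le_of_ne (mono _ _ h1.le) h

/-- Because `n * w` is an integer, translation by `w` maps the grid to itself. -/
theorem cellIndex_add {n L : ℕ} (hn : 0 < n) {w : ℝ} (hw : n * w = L) {x : ℝ} (hx : 0 < x) :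
    cellIndex n (x + w) = cellIndex n x + L := by
  have hn' : (0 : ℝ) < n := by exact_mod_cast hn
  have h1 : 0 < ⌈(n : ℝ) * x⌉₊ := Nat.ceil_pos.2 (by positivity)
  unfold cellIndex
  rw [mul_add, hw, Nat.ceil_add_natCast (by positivity)]
  omega

theorem mul_le_iff_cellIndex_lt {n : ℕ} (hn : 0 < n) {x : ℝ} (hx : 0 < x) (r : ℕ) :
    n * x ≤ r ↔ cellIndex n x < r := by
  have h1 := cellIndex_lt_mul hn hx
  have h2 := mul_le_cellIndex_add_one n x
  constructor
  · intro h
    exact_mod_cast h1.trans_le h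
  · intro h
    have : (cellIndex n x : ℝ) + 1 ≤ r := by exact_mod_cast h
    linarith

/-- Adding a point at distance `w` after `x` creates no window with `k` points, in terms of the
window counts of the original set. -/
theorem scanStat_add_cons_lt_iff {w : ℝ} (hw0 : 0 < w) {k : ℕ} {s : Finset ℝ}
    (hs : ∀ y ∈ s, y ∈ Set.Ioc (0 : ℝ) 1) {x : ℝ} (hx0 : 0 < x) (hx1 : x < 1 - w)
    (hx2 : x + (w + w) ∉ s) :
    scanStat w ((x + w) ::ₘ s.val) < k ↔ scanStat w s.val < k ∧
      ∀ t : ℝ, x ≤ t → t ≤ x + w → ptCount s.val (Set.Ioc t (t + w)) + 2 ≤ k := by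
  classical
  have hw1 : w ≤ 1 := by linarith
  constructor
  · intro h
    refine ⟨(scanStat_le_cons hw1 _ _).trans_lt h, ?_⟩
    have h1 : ∀ t, x ≤ t → t < x + w → t ≤ 1 - w →
        ptCount s.val (Set.Ioc t (t + w)) + 2 ≤ k := by
      intro t ht ht' ht1
      have h2 := ptCount_le_scanStat ((x + w) ::ₘ s.val) (hx0.le.trans ht) ht1
      rw [ptCount_cons, if_pos ⟨ht', by linarith⟩] at h2
      omega
    have h2 : ∀ t, x ≤ t → t < x + w → ptCount s.val (Set.Ioc t (t + w)) + 2 ≤ k := by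
      intro t ht ht'
      by_cases ht1 : t ≤ 1 - w
      · exact h1 t ht ht' ht1
      -- A window sticking out beyond `1` has no more points than the last admissible one, `(1 - w,
      -- 1]`.
      · have h3 := h1 (1 - w) hx1.le (by linarith) le_rfl
        have h4 : ptCount s.val (Set.Ioc t (t + w)) ≤
            ptCount s.val (Set.Ioc (1 - w) (1 - w + w)) :=
          ptCount_le_ptCount fun y hy hyt => ⟨by linarith [hyt.1], by linarith [(hs y hy).2]⟩
        omega
    intro t ht ht'
    rcases ht'.lt_or_eq with h3 | rfl
    · exact h2 t ht h3
    -- The window starting at `x + w` does not contain the added point, so its bound is a limit of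
    -- those for smaller `t`. Only a point at `x + 2w` could be lost in the limit, and there is
    -- none.
    · have hev : ∀ᶠ t in 𝓝[<] (x + w), ∀ y ∈ s, y < x + (w + w) → y ≤ t + w := by
        rw [eventually_all_finset]
        intro y _
        by_cases hy : y < x + (w + w)
        · have : Set.Ioi (y - w) ∈ 𝓝[<] (x + w) :=
            mem_nhdsWithin_of_mem_nhds (Ioi_mem_nhds (by linarith))
          filter_upwards [this] with t ht _
          have : y - w < t := ht
          linarith
        · exact Eventually.of_forall fun t h => absurd h hy
      have hev2 : ∀ᶠ t in 𝓝[<] (x + w), x < t :=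
        mem_nhdsWithin_of_mem_nhds (Ioi_mem_nhds (by linarith))
      obtain ⟨t, h4, h5, h6⟩ := (hev.and (hev2.and self_mem_nhdsWithin)).exists
      have h7 : t < x + w := h6
      refine le_trans ?_ (h2 t h5.le h7)
      gcongr
      refine ptCount_le_ptCount fun y hy hyt =>
        ⟨by linarith [hyt.1], h4 y hy (lt_of_le_of_ne (by linarith [hyt.2]) ?_)⟩
      rintro rfl
      exact hx2 hy
  · rintro ⟨h1, h2⟩
    obtain ⟨t, ht0, ht1, ht⟩ := exists_scanStat_eq hw1 ((x + w) ::ₘ s.val)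
    rw [ht, ptCount_cons]
    split_ifs with h
    · have := h2 t (by linarith [h.2]) h.1.le
      omega
    · have := ptCount_le_scanStat s.val ht0 ht1
      omega

open Classical in
/-- The number of cells `j` with exactly one point, such that cell `j + L` is empty, there are
`k - 2` points strictly between these cells, and putting a point into cell `j + L` creates no
discrete window with `k` points. -/
def gapCount (k L n : ℕ) (x : Fin n → ℕ) : ℝ :=
  ∑ j, if x j = 1 then (if h : j.val + L < n then
    (if x ⟨j.val + L, h⟩ = 0 ∧ windowSum (j.val + 1) (L - 1) x + 2 = k ∧
      ¬ k ≤ discreteScan L (x + Pi.single ⟨j.val + L, h⟩ 1) then 1 else 0) else 0) else 0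

theorem abs_gapCount_le (k L n : ℕ) (x : Fin n → ℕ) : |gapCount k L n x| ≤ ∑ j, (x j : ℝ) := by
  refine (Finset.abs_sum_le_sum_abs _ _).trans (Finset.sum_le_sum fun j _ => ?_)
  split_ifs with h <;> simp [h]

/-- A point in cell `j + L` acts as a virtual point at `x + w`, where `x` is the point in cell `j`.
The three exclusions settle the boundary cases: `1 - w` for the range of `x`, `x + w` for the
emptiness of cell `j + L` and the count between, `x + 2w` for `scanStat_add_cons_lt_iff`. They hold
almost surely for the process. -/
theorem eventually_gapCount_eq {p q k : ℕ} (hk : 0 < k) (hp : 0 < p) (hpq : p < q) {w : ℝ}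
    (hw : w = (p : ℝ) / q) {s : Finset ℝ} (hs : ∀ x ∈ s, x ∈ Set.Ioc (0 : ℝ) 1)
    (h1w : 1 - w ∉ s) (hs1 : ∀ x ∈ s, x + w ∉ s) (hs2 : ∀ x ∈ s, x + (w + w) ∉ s) :
    ∀ᶠ m : ℕ in atTop,
      gapCount k (m * p) (m * q) (cellCount (m * q) s.val) = nuFun w k s := by
  classical
  have hq : 0 < q := by omega
  have hq' : (0 : ℝ) < q := by exact_mod_cast hq
  have hw0 : 0 < w := by rw [hw]; positivity
  have h1 : ∀ᶠ m : ℕ in atTop, ∀ x ∈ s, x < 1 - w →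
      (k ≤ discreteScan (m * p) (cellCount (m * q) ((x + w) ::ₘ s.val)) ↔
        k ≤ scanStat w ((x + w) ::ₘ s.val)) := by
    rw [eventually_all_finset]
    intro x hx
    by_cases hx1 : x < 1 - w
    · have := eventually_le_discreteScan_iff hk hpq hw (s := (x + w) ::ₘ s.val) fun y hy => by
        rcases Multiset.mem_cons.1 hy with rfl | hy
        · exact ⟨by linarith [(hs x hx).1], by linarith⟩
        · exact hs _ hy
      filter_upwards [this] with m hm _ using hm
    · exact Eventually.of_forall fun m h => absurd h hx1
  have h2 : ∀ᶠ n : ℕ in atTop, ∀ x ∈ s, ∀ y ∈ s, cellIndex n y ≠ cellIndex n (x + w) := by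
    rw [eventually_all_finset]
    intro x hx
    rw [eventually_all_finset]
    intro y hy
    refine eventually_cellIndex_ne (hs y hy).1 (by linarith [(hs x hx).1]) ?_
    rintro rfl
    exact hs1 x hx hy
  filter_upwards [h1, eventually_gt_atTop 0,
    (tendsto_mul_atTop hq).eventually (eventually_injOn_cellIndex hs),
    (tendsto_mul_atTop hq).eventually h2] with m h1 hm hinj h2
  have hn : 0 < m * q := Nat.mul_pos hm hq
  have hL0 : 0 < m * p := Nat.mul_pos hm hp
  have hL : m * p ≤ m * q := Nat.mul_le_mul_left _ hpq.le
  have hnw : ((m * q : ℕ) : ℝ) * w = (m * p : ℕ) := by rw [hw]; push_cast; field_simp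
  rw [gapCount, sum_cellCount_eq_one hn hs hinj, nuFun, Nat.cast_sum, Finset.sum_filter]
  generalize m * q = n at *
  generalize m * p = L at *
  have hn' : (0 : ℝ) < n := by exact_mod_cast hn
  refine Finset.sum_congr rfl fun x hx => ?_
  have hx0 := (hs x hx).1
  rw [dif_pos (cellIndex_lt hn hx0 (hs x hx).2)]
  -- The grid condition amounts to `x ≤ 1 - w`; equality is excluded by `h1w`.
  have hlt : cellIndex n x + L < n ↔ x < 1 - w := by
    have e1 : cellIndex n x + L < n ↔ cellIndex n x < n - L := by omega
    rw [e1, ← mul_le_iff_cellIndex_lt hn hx0, Nat.cast_sub hL, ← hnw]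
    have e2 : (n : ℝ) - n * w = n * (1 - w) := by ring
    rw [e2, mul_le_mul_iff_right₀ hn']
    refine ⟨fun h => lt_of_le_of_ne h ?_, le_of_lt⟩
    rintro rfl
    exact h1w hx
  by_cases hxw : x < 1 - w
  · rw [dif_pos (hlt.2 hxw), if_pos hxw]
    have hu0 : 0 < x + w := by linarith
    have hu1 : x + w ≤ 1 := by linarith
    have hadd := cellIndex_add hn hnw hx0
    have hempty : cellCount n s.val ⟨cellIndex n x + L, hlt.2 hxw⟩ = 0 := by
      rw [cellCount_eq_card hn hs, Finset.card_eq_zero, Finset.filter_eq_empty_iff]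
      intro y hy h
      exact h2 x hx y hy (h.trans hadd.symm)
    have hmid : windowSum (cellIndex n x + 1) (L - 1) (cellCount n s.val) =
        ptCount s.val (Set.Ioc x (x + w)) := by
      have hlt' := hlt.2 hxw
      rw [windowSum_cellCount _ _ (by omega)]
      refine ptCount_congr fun y hy => ?_
      have hy0 := (hs y hy).1
      rw [Set.mem_Ioc, Set.mem_Ioc, div_lt_iff₀ hn', le_div_iff₀ hn']
      have e1 : ((cellIndex n x + 1 : ℕ) : ℝ) < y * n ↔ x < y := by
        rw [mul_comm, ← not_le, mul_le_iff_cellIndex_lt hn hy0]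
        by_cases hxy : y = x
        · subst hxy; simp
        · have hne : cellIndex n x ≠ cellIndex n y := fun h => hxy (hinj hy hx h.symm)
          rw [← cellIndex_lt_iff hn hne]
          omega
      have e2 : y * n ≤ ((cellIndex n x + 1 : ℕ) : ℝ) + ((L - 1 : ℕ) : ℝ) ↔ y ≤ x + w := by
        rw [← Nat.cast_add, mul_comm, mul_le_iff_cellIndex_lt hn hy0]
        have e3 : cellIndex n x + 1 + (L - 1) = cellIndex n (x + w) := by omega
        rw [e3, cellIndex_lt_iff hn (h2 x hx y hy)]
        refine ⟨le_of_lt, fun h => lt_of_le_of_ne h ?_⟩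
        rintro rfl
        exact hs1 x hx hy
      rw [e1, e2]
    have hscan : cellCount n s.val + Pi.single ⟨cellIndex n x + L, hlt.2 hxw⟩ 1 =
        cellCount n ((x + w) ::ₘ s.val) := by
      rw [cellCount_cons hn hu0 hu1]
      simp only [hadd]
    have hT : (¬ k ≤ discreteScan L
        (cellCount n s.val + Pi.single ⟨cellIndex n x + L, hlt.2 hxw⟩ 1)) ↔
        scanStat w s.val < k ∧
          ∀ t : ℝ, x ≤ t → t ≤ x + w → ptCount s.val (Set.Ioc t (t + w)) + 2 ≤ k := by
      rw [hscan, h1 x hx hxw, not_le, scanStat_add_cons_lt_iff hw0 hs hx0 hxw (hs2 x hx)]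
    rw [Nat.cast_ite, Nat.cast_one, Nat.cast_zero]
    refine if_congr ?_ rfl rfl
    exact ⟨fun h => ⟨(hT.1 h.2.2).1, (congrArg (· + 2) hmid).symm.trans h.2.1, (hT.1 h.2.2).2⟩,
      fun h => ⟨hempty, (congrArg (· + 2) hmid).trans h.2.1, hT.2 ⟨h.1, h.2.2⟩⟩⟩
  · rw [dif_neg (fun h => hxw (hlt.1 h)), if_neg hxw]

theorem IsPoissonProcess.integrable_nuFun_and_tendsto {Ω : Type*} [MeasurableSpace Ω]
    {P : Measure Ω} [IsProbabilityMeasure P] {lam : ℝ} (hlam : 0 ≤ lam) {X : Ω → Finset ℝ}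
    (hX : IsPoissonProcess lam X P) {p q k : ℕ} (hk : 0 < k) (hp : 0 < p) (hpq : p < q) {w : ℝ}
    (hw : w = (p : ℝ) / q) :
    Integrable (fun ω => (nuFun w k (X ω) : ℝ)) P ∧
    Tendsto (fun m : ℕ => ∫ ω, gapCount k (m * p) (m * q) (cellCount (m * q) (X ω).val) ∂P)
      atTop (𝓝 (∫ ω, (nuFun w k (X ω) : ℝ) ∂P)) := by
  have hq' : (0 : ℝ) < q := by exact_mod_cast (by omega : 0 < q)
  have hw0 : 0 < w := by rw [hw]; positivity
  have hmeas : ∀ m : ℕ, AEStronglyMeasurable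
      (fun ω => gapCount k (m * p) (m * q) (cellCount (m * q) (X ω).val)) P := fun m =>
    ((Measurable.of_discrete (f := gapCount k (m * p) (m * q))).comp
      (hX.measurable_cellCount _)).aestronglyMeasurable
  have hlim : ∀ᵐ ω ∂P, Tendsto (fun m : ℕ =>
      gapCount k (m * p) (m * q) (cellCount (m * q) (X ω).val)) atTop
      (𝓝 (nuFun w k (X ω) : ℝ)) := by
    filter_upwards [hX.ae_notMem hlam (1 - w), hX.ae_add_notMem hlam hw0,
      hX.ae_add_notMem hlam (add_pos hw0 hw0)] with ω h1 h2 h3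
    exact tendsto_nhds_of_eventually_eq
      (eventually_gapCount_eq hk hp hpq hw (hX.subset ω) h1 h2 h3)
  constructor
  · refine hX.integrable_card.mono' (aestronglyMeasurable_of_tendsto_ae atTop hmeas hlim)
      (Eventually.of_forall fun ω => ?_)
    rw [Real.norm_eq_abs, abs_of_nonneg (by positivity)]
    have : nuFun w k (X ω) ≤ (X ω).card := by
      classical
      unfold nuFun
      rw [← Finset.card_filter]
      exact (Finset.card_filter_le _ _).trans (Finset.card_filter_le _ _)
    exact_mod_cast this
  · refine tendsto_integral_filter_of_dominated_convergence (fun ω => ((X ω).card : ℝ))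
      (Eventually.of_forall hmeas) ?_ hX.integrable_card hlim
    filter_upwards [eventually_gt_atTop 0] with m hm
    refine Eventually.of_forall fun ω => ?_
    rw [Real.norm_eq_abs]
    refine (abs_gapCount_le _ _ _ _).trans ?_
    rw [← sum_cellCount (m * q) (X ω) (hX.subset ω) (Nat.mul_pos hm (by omega))]
    push_cast
    exact le_rfl

/-! ### Refining the cells -/

theorem windowSum_add {n : ℕ} (i L M : ℕ) (x : Fin n → ℕ) :
    windowSum i (L + M) x = windowSum i L x + windowSum (i + L) M x := by
  unfold windowSum
  rw [← Finset.sum_union]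
  · refine Finset.sum_congr ?_ fun _ _ => rfl
    ext r
    simp only [Finset.mem_filter, Finset.mem_univ, true_and, Finset.mem_union]
    omega
  · rw [Finset.disjoint_left]
    intro r
    simp only [Finset.mem_filter, Finset.mem_univ, true_and]
    omega

theorem windowSum_one {n : ℕ} (i : Fin n) (x : Fin n → ℕ) : windowSum i.val 1 x = x i := by
  unfold windowSum
  have : ({r : Fin n | i.val ≤ r.val ∧ r.val < i.val + 1} : Finset (Fin n)) = {i} := by
    ext r
    simp only [Finset.mem_filter, Finset.mem_univ, true_and, Finset.mem_singleton, Fin.ext_iff]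
    omega
  rw [this, Finset.sum_singleton]

theorem windowSum_cellCount_two_mul {n : ℕ} (j M : ℕ) (h : j + M ≤ n) (s : Multiset ℝ) :
    windowSum j M (cellCount n s) = windowSum (2 * j) (2 * M) (cellCount (2 * n) s) := by
  rw [windowSum_cellCount _ _ h, windowSum_cellCount _ _ (by omega)]
  push_cast
  rw [← mul_add, mul_div_mul_left _ _ two_ne_zero, mul_div_mul_left _ _ two_ne_zero]

theorem not_le_discreteScan_iff {n L k : ℕ} (hk : 0 < k) (hL : L ≤ n) (x : Fin n → ℕ) :
    ¬ k ≤ discreteScan L x ↔ ∀ j, j + L ≤ n → windowSum j L x < k := by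
  rw [le_discreteScan_iff hk hL]
  push Not
  rfl

theorem cellCount_two_mul {n : ℕ} (i : ℕ) (hi : i < n) (s : Multiset ℝ) :
    cellCount n s ⟨i, hi⟩ = cellCount (2 * n) s ⟨2 * i, by omega⟩ +
      cellCount (2 * n) s ⟨2 * i + 1, by omega⟩ := by
  have h := windowSum_cellCount_two_mul (n := n) i 1 (by omega) s
  have h1 := windowSum_one ⟨i, hi⟩ (cellCount n s)
  have h2 := windowSum_one ⟨2 * i, by omega⟩ (cellCount (2 * n) s)
  have h3 := windowSum_one ⟨2 * i + 1, by omega⟩ (cellCount (2 * n) s)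
  have h4 : windowSum (2 * i) (2 * 1) (cellCount (2 * n) s) = _ := windowSum_add (2 * i) 1 1 _
  dsimp only at h1 h2 h3
  omega

/-- The shifted window and its two unshifted neighbours share the `2 * (L - 1)` half cells in the
middle and differ only in the four half cells of the coarse cells `i` and `i + L`. -/
theorem windowSum_split {n : ℕ} (i L : ℕ) (hL : 0 < L) (hi : i + L < n) (x : Fin (2 * n) → ℕ) :
    windowSum (2 * i + 1) (2 * L) x = x ⟨2 * i + 1, by omega⟩ +
      windowSum (2 * i + 2) (2 * (L - 1)) x + x ⟨2 * (i + L), by omega⟩ ∧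
    windowSum (2 * i) (2 * L) x = x ⟨2 * i, by omega⟩ + x ⟨2 * i + 1, by omega⟩ +
      windowSum (2 * i + 2) (2 * (L - 1)) x ∧
    windowSum (2 * (i + 1)) (2 * L) x = windowSum (2 * i + 2) (2 * (L - 1)) x +
      x ⟨2 * (i + L), by omega⟩ + x ⟨2 * (i + L) + 1, by omega⟩ := by
  have h1 := windowSum_one ⟨2 * i, by omega⟩ x
  have h2 := windowSum_one ⟨2 * i + 1, by omega⟩ x
  have h3 := windowSum_one ⟨2 * (i + L), by omega⟩ x
  have h4 := windowSum_one ⟨2 * (i + L) + 1, by omega⟩ x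
  dsimp only at h1 h2 h3 h4
  obtain ⟨l, rfl⟩ : ∃ l, L = l + 1 := ⟨L - 1, by omega⟩
  refine ⟨?_, ?_, ?_⟩
  · have e : 2 * (l + 1) = 1 + 2 * (l + 1 - 1) + 1 := by omega
    rw [e, windowSum_add, windowSum_add, ← h2, ← h3]
    congr 2
    omega
  · have e : 2 * (l + 1) = 1 + 1 + 2 * (l + 1 - 1) := by omega
    rw [e, windowSum_add, windowSum_add, ← h2, ← h1]
  · have e : 2 * (l + 1) = 2 * (l + 1 - 1) + 1 + 1 := by omega
    have e2 : 2 * (i + 1) + 2 * (l + 1 - 1) = 2 * (i + (l + 1)) := by omega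
    have e3 : 2 * (i + 1) + (2 * (l + 1 - 1) + 1) = 2 * (i + (l + 1)) + 1 := by omega
    rw [e, windowSum_add, windowSum_add, ← h3, ← h4, e2, e3]
    rfl

/-- Bonferroni's lower bound, with the number of pairs estimated generously by the square of the
cardinality. -/
theorem sum_sub_le_measureReal_biUnion {α ι : Type*} [MeasurableSpace α] (μ : Measure α)
    [IsFiniteMeasure μ] (E : ι → Set α) (hE : ∀ i, MeasurableSet (E i)) {ε : ℝ} (hε : 0 ≤ ε)
    (S : Finset ι)
    (h : ∀ i ∈ S, ∀ j ∈ S, i ≠ j → μ.real (E i ∩ E j) ≤ ε) :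
    ∑ i ∈ S, μ.real (E i) - (S.card : ℝ) ^ 2 * ε ≤ μ.real (⋃ i ∈ S, E i) := by
  classical
  induction S using Finset.induction_on with
  | empty => simp
  | insert a S ha ih =>
    have ih' := ih fun i hi j hj => h i (Finset.mem_insert_of_mem hi) j (Finset.mem_insert_of_mem hj)
    rw [Finset.set_biUnion_insert, Finset.sum_insert ha, Finset.card_insert_of_notMem ha]
    have hu := measureReal_union_add_inter (μ := μ) (s := E a)
      (Finset.measurableSet_biUnion S fun i _ => hE i) (measure_ne_top _ _) (measure_ne_top _ _)
    have hi : μ.real (E a ∩ ⋃ i ∈ S, E i) ≤ S.card * ε := by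
      rw [Set.inter_iUnion₂]
      refine (measureReal_biUnion_finset_le S _).trans ?_
      rw [← nsmul_eq_mul]
      refine Finset.sum_le_card_nsmul _ _ _ fun j hj => ?_
      exact h a (Finset.mem_insert_self _ _) j (Finset.mem_insert_of_mem hj)
        (by rintro rfl; exact ha hj)
    push_cast
    have : 0 ≤ (S.card : ℝ) * ε := by positivity
    nlinarith

/-! ### The probability gained by halving the mesh -/

namespace IsPoissonProcess

variable {Ω : Type*} [MeasurableSpace Ω] {P : Measure Ω} {lam : ℝ} {X : Ω → Finset ℝ}

theorem measureReal_forall_one_le [IsProbabilityMeasure P] (hX : IsPoissonProcess lam X P)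
    (hlam : 0 ≤ lam) {n : ℕ} (hn : 0 < n) (S : Finset (Fin n)) :
    P.real {ω | ∀ j ∈ S, 1 ≤ cellCount n (X ω).val j} ≤ (lam / n) ^ S.card := by
  have h := hX.measureReal_forall_cellCount_mem hn S (fun _ => {y | 1 ≤ y})
  rw [Finset.prod_const] at h
  refine h.trans_le ?_
  gcongr
  exact poisson_real_pos_le (by positivity)

theorem measureReal_two_le_and [IsProbabilityMeasure P] (hX : IsPoissonProcess lam X P)
    (hlam : 0 ≤ lam) {n : ℕ} (hn : 0 < n) {i j : Fin n} (hij : i ≠ j) :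
    P.real {ω | 2 ≤ cellCount n (X ω).val i ∧ 1 ≤ cellCount n (X ω).val j} ≤
      (lam / n) ^ 3 := by
  have h := hX.measureReal_forall_cellCount_mem hn {i, j}
    (fun r => if r = i then {y | 2 ≤ y} else {y | 1 ≤ y})
  rw [Finset.prod_pair hij, if_pos rfl, if_neg hij.symm] at h
  have ha : 0 ≤ lam / n := by positivity
  calc P.real {ω | 2 ≤ cellCount n (X ω).val i ∧ 1 ≤ cellCount n (X ω).val j}
      = _ := by
        rw [← h]
        congr 1
        ext ω
        simp [hij.symm]
    _ ≤ (lam / n) ^ 2 * (lam / n) :=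
        mul_le_mul (poisson_real_two_le ha) (poisson_real_pos_le ha) measureReal_nonneg (by positivity)
    _ = _ := by ring

/-- The configuration of half cells around the window of coarse cells `i, ..., i + L` shifted by half
a cell: the half cells just outside the shifted window are empty, there are `k - 2` points strictly
between its two extreme half cells, and no unshifted window has `k` points. -/
def shiftedWindow (k L n i : ℕ) (hi : i + L < n) (x : Fin (2 * n) → ℕ) : Prop :=
  x ⟨2 * i, by omega⟩ = 0 ∧ x ⟨2 * (i + L) + 1, by omega⟩ = 0 ∧
    windowSum (2 * i + 2) (2 * (L - 1)) x + 2 = k ∧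
    ∀ j, j + L ≤ n → windowSum (2 * j) (2 * L) x < k

/-- Removing the two extreme points on the fine grid costs `(lam / (2n))²`; removing the point of
cell `i` on the coarse grid costs `lam / n`. Both sides reduce to the same event with cells `i` and
`i + L` empty, and the quotient of the costs is `lam / (4n)`. -/
theorem measureReal_shiftedWindow [IsProbabilityMeasure P] (hX : IsPoissonProcess lam X P)
    (hlam : 0 ≤ lam) {k L n i : ℕ} (hk : 0 < k) (hL : 0 < L) (hi : i + L < n) :
    P.real {ω | cellCount (2 * n) (X ω).val ⟨2 * i + 1, by omega⟩ = 1 ∧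
      (cellCount (2 * n) (X ω).val ⟨2 * (i + L), by omega⟩ = 1 ∧
        shiftedWindow k L n i hi (cellCount (2 * n) (X ω).val))} =
    lam / n / 4 * P.real {ω | cellCount n (X ω).val ⟨i, by omega⟩ = 1 ∧
      (cellCount n (X ω).val ⟨i + L, hi⟩ = 0 ∧
        windowSum (i + 1) (L - 1) (cellCount n (X ω).val) + 2 = k ∧
        ¬ k ≤ discreteScan L (cellCount n (X ω).val + Pi.single ⟨i + L, hi⟩ 1))} := by
  have hn : 0 < n := by omega
  have hn2 : 0 < 2 * n := by omega
  have hbc : (⟨2 * i + 1, by omega⟩ : Fin (2 * n)) ≠ ⟨2 * (i + L), by omega⟩ := by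
    rw [Ne, Fin.mk.injEq]; omega
  have e1 := hX.measureReal_cellCount_one_eq hlam hn2 ⟨2 * i + 1, by omega⟩
    (fun x => x ⟨2 * (i + L), by omega⟩ = 1 ∧ shiftedWindow k L n i hi x)
  have e2 := hX.measureReal_cellCount_one_eq hlam hn2 ⟨2 * (i + L), by omega⟩
    (fun x => x ⟨2 * i + 1, by omega⟩ = 0 ∧
      shiftedWindow k L n i hi (x + Pi.single ⟨2 * i + 1, by omega⟩ 1))
  have e3 := hX.measureReal_cellCount_one_eq hlam hn ⟨i, by omega⟩
    (fun x => x ⟨i + L, hi⟩ = 0 ∧ windowSum (i + 1) (L - 1) x + 2 = k ∧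
        ¬ k ≤ discreteScan L (x + Pi.single ⟨i + L, hi⟩ 1))
  beta_reduce at e1 e2 e3
  have s1 : {ω | cellCount (2 * n) (X ω).val ⟨2 * i + 1, by omega⟩ = 0 ∧
      (cellCount (2 * n) (X ω).val + Pi.single ⟨2 * i + 1, by omega⟩ 1 : Fin (2 * n) → ℕ)
        ⟨2 * (i + L), by omega⟩ = 1 ∧
      shiftedWindow k L n i hi (cellCount (2 * n) (X ω).val +
        Pi.single ⟨2 * i + 1, by omega⟩ 1)} =
      {ω | cellCount (2 * n) (X ω).val ⟨2 * (i + L), by omega⟩ = 1 ∧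
        cellCount (2 * n) (X ω).val ⟨2 * i + 1, by omega⟩ = 0 ∧
      shiftedWindow k L n i hi (cellCount (2 * n) (X ω).val +
        Pi.single ⟨2 * i + 1, by omega⟩ 1)} := by
    ext ω
    simp only [Set.mem_ofPred_eq, Pi.add_apply, Pi.single_eq_of_ne hbc.symm, add_zero]
    tauto
  -- With both points removed, emptiness of the four half cells is emptiness of the two coarse
  -- cells, and a window on coarse boundaries cannot tell in which half the points are put back.
  have s2 : {ω | cellCount (2 * n) (X ω).val ⟨2 * (i + L), by omega⟩ = 0 ∧
      (cellCount (2 * n) (X ω).val + Pi.single ⟨2 * (i + L), by omega⟩ 1 : Fin (2 * n) → ℕ)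
        ⟨2 * i + 1, by omega⟩ = 0 ∧
      shiftedWindow k L n i hi (cellCount (2 * n) (X ω).val +
        Pi.single ⟨2 * (i + L), by omega⟩ 1 + Pi.single ⟨2 * i + 1, by omega⟩ 1)} =
      {ω | cellCount n (X ω).val ⟨i, by omega⟩ = 0 ∧
        (cellCount n (X ω).val + Pi.single ⟨i, by omega⟩ 1 : Fin n → ℕ) ⟨i + L, hi⟩ = 0 ∧
        windowSum (i + 1) (L - 1) (cellCount n (X ω).val + Pi.single ⟨i, by omega⟩ 1) + 2 = k ∧
        ¬ k ≤ discreteScan L (cellCount n (X ω).val + Pi.single ⟨i, by omega⟩ 1 +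
          Pi.single ⟨i + L, hi⟩ 1)} := by
    ext ω
    have n1 : (⟨i + L, hi⟩ : Fin n) ≠ ⟨i, by omega⟩ := by rw [Ne, Fin.mk.injEq]; omega
    have n2 : (⟨2 * i, by omega⟩ : Fin (2 * n)) ≠ ⟨2 * i + 1, by omega⟩ := by
      rw [Ne, Fin.mk.injEq]; omega
    have n3 : (⟨2 * i, by omega⟩ : Fin (2 * n)) ≠ ⟨2 * (i + L), by omega⟩ := by
      rw [Ne, Fin.mk.injEq]; omega
    have n4 : (⟨2 * (i + L) + 1, by omega⟩ : Fin (2 * n)) ≠ ⟨2 * i + 1, by omega⟩ := by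
      rw [Ne, Fin.mk.injEq]; omega
    have n5 : (⟨2 * (i + L) + 1, by omega⟩ : Fin (2 * n)) ≠ ⟨2 * (i + L), by omega⟩ := by
      rw [Ne, Fin.mk.injEq]; omega
    rw [Set.mem_ofPred_eq, Set.mem_ofPred_eq, not_le_discreteScan_iff hk (by omega)]
    simp only [shiftedWindow, Pi.add_apply, windowSum_add_single, Pi.single_eq_of_ne n1,
      Pi.single_eq_of_ne n2, Pi.single_eq_of_ne n3, Pi.single_eq_of_ne n4,
      Pi.single_eq_of_ne n5, Pi.single_eq_of_ne hbc, add_zero]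
    have c1 := cellCount_two_mul i (by omega : i < n) (X ω).val
    have c2 := cellCount_two_mul (i + L) hi (X ω).val
    have c3 := windowSum_cellCount_two_mul (n := n) (i + 1) (L - 1) (by omega) (X ω).val
    rw [mul_add, mul_one] at c3
    rw [if_neg (by omega : ¬ (2 * i + 2 ≤ 2 * (i + L) ∧ _)),
      if_neg (by omega : ¬ (2 * i + 2 ≤ 2 * i + 1 ∧ _)),
      if_neg (by omega : ¬ (i + 1 ≤ i ∧ _)), c1, c2, c3]
    have hw : (∀ j, j + L ≤ n → windowSum (2 * j) (2 * L) (cellCount (2 * n) (X ω).val) +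
          (if 2 * j ≤ 2 * (i + L) ∧ 2 * (i + L) < 2 * j + 2 * L then 1 else 0) +
          (if 2 * j ≤ 2 * i + 1 ∧ 2 * i + 1 < 2 * j + 2 * L then 1 else 0) < k) ↔
        (∀ j, j + L ≤ n → windowSum j L (cellCount n (X ω).val) +
          (if j ≤ i ∧ i < j + L then 1 else 0) +
          (if j ≤ i + L ∧ i + L < j + L then 1 else 0) < k) := by
      refine forall_congr' fun j => forall_congr' fun hj => ?_
      rw [windowSum_cellCount_two_mul j L hj]
      split_ifs <;> omega
    rw [hw]
    constructor
    · rintro ⟨g1, g2, g3, g4, g5, g6⟩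
      exact ⟨by omega, by omega, by omega, g6⟩
    · rintro ⟨g1, g2, g3, g4⟩
      exact ⟨by omega, by omega, by omega, by omega, by omega, g4⟩
  rw [e1, s1, e2, s2, e3]
  push_cast
  ring

/-- If the shifted window has `k` points and its unshifted neighbours fewer, then `c` holds more
points than `b'` and `b` more than `c'`, so `b` and `c` are occupied. Outside `C1` to `C4`, which
require a third point in these half cells and have probability of order `n⁻³`, this forces one point
in each of `b` and `c`, none in `b'` and `c'`, and `k - 2` between. -/
theorem abs_measureReal_window_sub_le [IsProbabilityMeasure P] (hX : IsPoissonProcess lam X P)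
    (hlam : 0 ≤ lam) {k L n i : ℕ} (hk : 0 < k) (hL : 0 < L) (hi : i + L < n) :
    |P.real {ω | ¬ k ≤ discreteScan L (cellCount n (X ω).val) ∧
        k ≤ windowSum (2 * i + 1) (2 * L) (cellCount (2 * n) (X ω).val)} -
      lam / n / 4 * P.real {ω | cellCount n (X ω).val ⟨i, by omega⟩ = 1 ∧
      (cellCount n (X ω).val ⟨i + L, hi⟩ = 0 ∧
        windowSum (i + 1) (L - 1) (cellCount n (X ω).val) + 2 = k ∧
        ¬ k ≤ discreteScan L (cellCount n (X ω).val + Pi.single ⟨i + L, hi⟩ 1))}| ≤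
      4 * (lam / (2 * n : ℕ)) ^ 3 := by
  classical
  have hn2 : 0 < 2 * n := by omega
  rw [← hX.measureReal_shiftedWindow hlam hk hL hi]
  set b : Fin (2 * n) := ⟨2 * i + 1, by omega⟩ with hb
  set c : Fin (2 * n) := ⟨2 * (i + L), by omega⟩ with hc
  set b' : Fin (2 * n) := ⟨2 * i, by omega⟩ with hb'
  set c' : Fin (2 * n) := ⟨2 * (i + L) + 1, by omega⟩ with hc'
  have hbc : b ≠ c := by rw [hb, hc, Ne, Fin.mk.injEq]; omega
  have hbb : b' ≠ b := by rw [hb, hb', Ne, Fin.mk.injEq]; omega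
  have hbc' : b' ≠ c := by rw [hc, hb', Ne, Fin.mk.injEq]; omega
  have hcb : c' ≠ b := by rw [hb, hc', Ne, Fin.mk.injEq]; omega
  have hcc : c' ≠ c := by rw [hc, hc', Ne, Fin.mk.injEq]; omega
  set C1 := {ω | ∀ j ∈ ({b', b, c} : Finset (Fin (2 * n))), 1 ≤ cellCount (2 * n) (X ω).val j}
  set C2 := {ω | ∀ j ∈ ({c', b, c} : Finset (Fin (2 * n))), 1 ≤ cellCount (2 * n) (X ω).val j}
  set C3 := {ω | 2 ≤ cellCount (2 * n) (X ω).val b ∧ 1 ≤ cellCount (2 * n) (X ω).val c}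
  set C4 := {ω | 2 ≤ cellCount (2 * n) (X ω).val c ∧ 1 ≤ cellCount (2 * n) (X ω).val b}
  have h1 : P.real C1 ≤ (lam / (2 * n : ℕ)) ^ 3 := by
    have := hX.measureReal_forall_one_le hlam hn2 {b', b, c}
    rwa [Finset.card_eq_three.2 ⟨b', b, c, hbb, hbc', hbc, rfl⟩] at this
  have h2 : P.real C2 ≤ (lam / (2 * n : ℕ)) ^ 3 := by
    have := hX.measureReal_forall_one_le hlam hn2 {c', b, c}
    rwa [Finset.card_eq_three.2 ⟨c', b, c, hcb, hcc, hbc, rfl⟩] at this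
  have h3 : P.real C3 ≤ (lam / (2 * n : ℕ)) ^ 3 := hX.measureReal_two_le_and hlam hn2 hbc
  have h4 : P.real C4 ≤ (lam / (2 * n : ℕ)) ^ 3 := hX.measureReal_two_le_and hlam hn2 hbc.symm
  refine (abs_measureReal_sub_le P (C := C1 ∪ C2 ∪ (C3 ∪ C4)) fun ω hω => ?_).trans ?_
  · obtain ⟨f1, f2, f3⟩ := windowSum_split i L hL hi (cellCount (2 * n) (X ω).val)
    rw [← hb, ← hc] at f1
    rw [← hb, ← hb'] at f2
    rw [← hc, ← hc'] at f3
    simp only [C1, C2, C3, C4, Set.mem_union, Set.mem_ofPred_eq, Finset.mem_insert,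
      Finset.mem_singleton, forall_eq_or_imp, forall_eq, not_or] at hω
    rw [Set.mem_ofPred_eq, Set.mem_ofPred_eq, not_le_discreteScan_iff hk (by omega), f1,
      shiftedWindow, ← hb', ← hc']
    have hw : (∀ j, j + L ≤ n → windowSum j L (cellCount n (X ω).val) < k) ↔
        ∀ j, j + L ≤ n → windowSum (2 * j) (2 * L) (cellCount (2 * n) (X ω).val) < k := by
      refine forall_congr' fun j => forall_congr' fun hj => ?_
      rw [windowSum_cellCount_two_mul j L hj]
    rw [hw]
    constructor
    · rintro ⟨g1, g2⟩
      have g3 := g1 i (by omega)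
      have g4 := g1 (i + 1) (by omega)
      refine ⟨?_, ?_, ?_, ?_, ?_, g1⟩ <;> omega
    · rintro ⟨g1, g2, g3, g4, g5, g6⟩
      exact ⟨g6, by omega⟩
  · have u1 := measureReal_union_le (μ := P) (C1 ∪ C2) (C3 ∪ C4)
    have u2 := measureReal_union_le (μ := P) C1 C2
    have u3 := measureReal_union_le (μ := P) C3 C4
    linarith

/-- Each shifted window requires its two extreme half cells to be occupied. The left ones have odd
index and the right ones even index, so two different windows involve four distinct half cells. -/
theorem measureReal_two_windows_le [IsProbabilityMeasure P] (hX : IsPoissonProcess lam X P)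
    (hlam : 0 ≤ lam) {k L n i j : ℕ} (hk : 0 < k) (hL : 0 < L) (hi : i + L < n) (hj : j + L < n)
    (hij : i ≠ j) :
    P.real ({ω | ¬ k ≤ discreteScan L (cellCount n (X ω).val) ∧
        k ≤ windowSum (2 * i + 1) (2 * L) (cellCount (2 * n) (X ω).val)} ∩
      {ω | ¬ k ≤ discreteScan L (cellCount n (X ω).val) ∧
        k ≤ windowSum (2 * j + 1) (2 * L) (cellCount (2 * n) (X ω).val)}) ≤
      (lam / (2 * n : ℕ)) ^ 4 := by
  classical
  have hn2 : 0 < 2 * n := by omega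
  have hsub : ∀ (i : ℕ) (hi : i + L < n) (ω : Ω), (¬ k ≤ discreteScan L (cellCount n (X ω).val) ∧
        k ≤ windowSum (2 * i + 1) (2 * L) (cellCount (2 * n) (X ω).val)) →
      1 ≤ cellCount (2 * n) (X ω).val ⟨2 * i + 1, by omega⟩ ∧
      1 ≤ cellCount (2 * n) (X ω).val ⟨2 * (i + L), by omega⟩ := by
    rintro i hi ω ⟨h1, h2⟩
    rw [not_le_discreteScan_iff hk (by omega)] at h1
    obtain ⟨f1, f2, f3⟩ := windowSum_split i L hL hi (cellCount (2 * n) (X ω).val)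
    have g1 := h1 i (by omega)
    have g2 := h1 (i + 1) (by omega)
    rw [windowSum_cellCount_two_mul _ _ (by omega)] at g1 g2
    constructor <;> omega
  set S : Finset (Fin (2 * n)) := {⟨2 * i + 1, by omega⟩, ⟨2 * (i + L), by omega⟩,
    ⟨2 * j + 1, by omega⟩, ⟨2 * (j + L), by omega⟩} with hS
  have hcard : S.card = 4 := by
    rw [hS, Finset.card_insert_of_notMem, Finset.card_insert_of_notMem, Finset.card_pair] <;>
      simp only [Finset.mem_insert, Finset.mem_singleton, Fin.mk.injEq, ne_eq] <;> omega
  have h := hX.measureReal_forall_one_le hlam hn2 S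
  rw [hcard] at h
  refine (measureReal_mono ?_).trans h
  rintro ω ⟨h1, h2⟩
  have g1 := hsub i hi ω h1
  have g2 := hsub j hj ω h2
  simp only [hS, Set.mem_ofPred_eq, Finset.mem_insert, Finset.mem_singleton, forall_eq_or_imp,
    forall_eq]
  exact ⟨g1.1, g1.2, g2.1, g2.2⟩

theorem integral_gapCount [IsProbabilityMeasure P] (hX : IsPoissonProcess lam X P) (k L n : ℕ) :
    ∫ ω, gapCount k L n (cellCount n (X ω).val) ∂P =
      ∑ i : Fin n, if h : i.val + L < n then
        P.real {ω | cellCount n (X ω).val i = 1 ∧ (cellCount n (X ω).val ⟨i.val + L, h⟩ = 0 ∧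
          windowSum (i.val + 1) (L - 1) (cellCount n (X ω).val) + 2 = k ∧
          ¬ k ≤ discreteScan L (cellCount n (X ω).val + Pi.single ⟨i.val + L, h⟩ 1))} else 0 := by
  classical
  rw [← integral_map (hX.measurable_cellCount n).aemeasurable
    (Measurable.of_discrete (f := gapCount k L n)).aestronglyMeasurable]
  have hprob : IsProbabilityMeasure (P.map fun ω => cellCount n (X ω).val) :=
    Measure.isProbabilityMeasure_map (hX.measurable_cellCount n).aemeasurable
  unfold gapCount
  rw [integral_finsetSum]
  · refine Finset.sum_congr rfl fun i _ => ?_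
    split_ifs with h
    · have e := integral_ite_one (P.map fun ω => cellCount n (X ω).val)
        (fun x => x i = 1 ∧ (x ⟨i.val + L, h⟩ = 0 ∧ windowSum (i.val + 1) (L - 1) x + 2 = k ∧
          ¬ k ≤ discreteScan L (x + Pi.single ⟨i.val + L, h⟩ 1)))
      rw [map_measureReal_apply (hX.measurable_cellCount n) .of_discrete] at e
      simp only [ite_and] at e ⊢
      exact e
    · simp
  · intro i _
    refine integrable_of_abs_le (C := 1) _ fun x => ?_
    split_ifs <;> simp

/-- Fine windows with even start are the coarse windows, so the gain is the probability of a union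
over odd starts. At most `n` single-window errors of order `n⁻³` and at most `n²` overlaps of order
`n⁻⁴` add up to `O(n⁻²)`. -/
theorem abs_refine_sub_le [IsProbabilityMeasure P] (hX : IsPoissonProcess lam X P)
    (hlam : 0 ≤ lam) {k L n : ℕ} (hk : 0 < k) (hL : 0 < L) (hLn : L ≤ n) :
    |P.real {ω | k ≤ discreteScan (2 * L) (cellCount (2 * n) (X ω).val)} -
      P.real {ω | k ≤ discreteScan L (cellCount n (X ω).val)} -
      lam / n / 4 * ∫ ω, gapCount k L n (cellCount n (X ω).val) ∂P| ≤
      (lam ^ 3 + lam ^ 4) * (1 / (n : ℝ) ^ 2) := by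
  classical
  have hn : 0 < n := by omega
  have hn' : (0 : ℝ) < n := by exact_mod_cast hn
  set E : Fin n → Set Ω := fun i => {ω | ¬ k ≤ discreteScan L (cellCount n (X ω).val) ∧
    k ≤ windowSum (2 * i.val + 1) (2 * L) (cellCount (2 * n) (X ω).val)} with hE
  set S : Finset (Fin n) := {i | i.val + L < n} with hS
  have hEm : ∀ i, MeasurableSet (E i) := fun i =>
    (hX.measurableSet_cellCount n (fun x => ¬ k ≤ discreteScan L x)).inter
      (hX.measurableSet_cellCount (2 * n) (fun x => k ≤ windowSum (2 * i.val + 1) (2 * L) x))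
  have hsub : {ω | k ≤ discreteScan L (cellCount n (X ω).val)} ⊆
      {ω | k ≤ discreteScan (2 * L) (cellCount (2 * n) (X ω).val)} := by
    intro ω hω
    rw [Set.mem_ofPred_eq, le_discreteScan_iff hk hLn] at hω
    rw [Set.mem_ofPred_eq, le_discreteScan_iff hk (by omega)]
    obtain ⟨j, hj, hj'⟩ := hω
    exact ⟨2 * j, by omega, by rwa [← windowSum_cellCount_two_mul j L hj]⟩
  have hdiff : P.real {ω | k ≤ discreteScan (2 * L) (cellCount (2 * n) (X ω).val)} -
      P.real {ω | k ≤ discreteScan L (cellCount n (X ω).val)} = P.real (⋃ i ∈ S, E i) := by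
    rw [← measureReal_sdiff hsub (hX.measurableSet_cellCount n (fun x => k ≤ discreteScan L x))]
    congr 1
    ext ω
    simp only [Set.mem_sdiff, Set.mem_ofPred_eq, Set.mem_iUnion, hE, hS, Finset.mem_filter,
      Finset.mem_univ, true_and, exists_prop]
    constructor
    · rintro ⟨h1, h2⟩
      rw [le_discreteScan_iff hk (by omega)] at h1
      obtain ⟨j, hj, hj'⟩ := h1
      rcases Nat.even_or_odd' j with ⟨i, rfl | rfl⟩
      · rw [← windowSum_cellCount_two_mul i L (by omega)] at hj'
        exact absurd ((le_discreteScan_iff hk hLn _).2 ⟨i, by omega, hj'⟩) h2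
      · exact ⟨⟨i, by omega⟩, by dsimp only; omega, h2, hj'⟩
    · rintro ⟨i, hi, h2, h3⟩
      exact ⟨(le_discreteScan_iff hk (by omega) _).2 ⟨2 * i.val + 1, by omega, h3⟩, h2⟩
  have hSn : (S.card : ℝ) ≤ n := by
    have := Finset.card_le_univ S
    rw [Fintype.card_fin] at this
    exact_mod_cast this
  set A : ℝ := lam / (2 * n : ℕ) with hA
  have hA0 : 0 ≤ A := by positivity
  have hlow := sum_sub_le_measureReal_biUnion P E hEm (ε := A ^ 4) (by positivity) S (by
    intro i hi j hj hij
    rw [hS, Finset.mem_filter] at hi hj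
    exact hX.measureReal_two_windows_le hlam hk hL hi.2 hj.2 fun h => hij (Fin.ext h))
  have hupp : P.real (⋃ i ∈ S, E i) ≤ ∑ i ∈ S, P.real (E i) := measureReal_biUnion_finset_le S E
  have hsum : |∑ i ∈ S, P.real (E i) -
      lam / n / 4 * ∫ ω, gapCount k L n (cellCount n (X ω).val) ∂P| ≤ n * (4 * A ^ 3) := by
    rw [hX.integral_gapCount, hS, Finset.sum_filter, Finset.mul_sum, ← Finset.sum_sub_distrib]
    refine (Finset.abs_sum_le_sum_abs _ _).trans ?_
    refine (Finset.sum_le_card_nsmul _ _ (4 * A ^ 3) fun i _ => ?_).trans (by simp)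
    by_cases h : i.val + L < n
    · rw [if_pos h, dif_pos h]
      exact hX.abs_measureReal_window_sub_le hlam hk hL h
    · rw [if_neg h, dif_neg h]
      simp only [mul_zero, sub_zero, abs_zero]
      positivity
  have hcard : (S.card : ℝ) ^ 2 * A ^ 4 ≤ (n : ℝ) ^ 2 * A ^ 4 := by gcongr
  have hfin : n * (4 * A ^ 3) + (n : ℝ) ^ 2 * A ^ 4 ≤ (lam ^ 3 + lam ^ 4) * (1 / (n : ℝ) ^ 2) := by
    have e : n * (4 * A ^ 3) + (n : ℝ) ^ 2 * A ^ 4 =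
        (lam ^ 3 / 2 + lam ^ 4 / 16) * (1 / (n : ℝ) ^ 2) := by
      rw [hA]; push_cast; field_simp; ring
    rw [e]
    gcongr
    · linarith [pow_nonneg hlam 3]
    · linarith [pow_nonneg hlam 4]
  rw [hdiff]
  have : 0 ≤ (n : ℝ) ^ 2 * A ^ 4 := by positivity
  rw [abs_le] at *
  constructor <;> linarith [hsum.1, hsum.2]

end IsPoissonProcess

/-! ### From the halving increments to the continuous limit -/

/-- If the increments of `f` from `m` to `2 * m` are asymptotic to `c / m`, then the distance of `f`
to its limit is asymptotic to `2 * c / m`. -/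
theorem tendsto_mul_sub_of_doubling {f : ℕ → ℝ} {l c : ℝ} (hf : Tendsto f atTop (𝓝 l))
    (h : Tendsto (fun m : ℕ => (m : ℝ) * (f (2 * m) - f m)) atTop (𝓝 c)) :
    Tendsto (fun m : ℕ => (m : ℝ) * (l - f m)) atTop (𝓝 (2 * c)) := by
  rw [Metric.tendsto_atTop] at h ⊢
  intro ε hε
  obtain ⟨M, hM⟩ := h (ε / 4) (by positivity)
  refine ⟨M + 1, fun m hm => ?_⟩
  have hm0 : (0 : ℝ) < m := by exact_mod_cast (by omega : 0 < m)
  -- The increments `c / (2 ^ J * m)` form a geometric series, and so do their errors `ε / 4 / (2 ^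
  -- J * m)`. The bound holds for all `J` at once, so `J` can go to infinity with `m` fixed.
  have key : ∀ J : ℕ, |f (2 ^ J * m) - f m - 2 * c / m * (1 - (1 / 2) ^ J)| ≤
      ε / 2 / m * (1 - (1 / 2) ^ J) := by
    intro J
    induction J with
    | zero => simp
    | succ J ih =>
      have hJm : m ≤ 2 ^ J * m := Nat.le_mul_of_pos_left m (by positivity)
      have h1 := (hM (2 ^ J * m) (by omega)).le
      rw [Real.dist_eq] at h1
      push_cast at h1
      have hJ0 : (0 : ℝ) < 2 ^ J * m := by positivity
      have e1 : f (2 ^ (J + 1) * m) - f (2 ^ J * m) - c / (2 ^ J * m) =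
          (2 ^ J * m * (f (2 * (2 ^ J * m)) - f (2 ^ J * m)) - c) / (2 ^ J * m) := by
        rw [pow_succ', mul_assoc]
        field_simp
      have h2 : |f (2 ^ (J + 1) * m) - f (2 ^ J * m) - c / (2 ^ J * m)| ≤
          ε / 4 / (2 ^ J * m) := by
        rw [e1, abs_div, abs_of_pos hJ0]
        gcongr
      have e2 : c / (2 ^ J * m) = 2 * c / m * ((1 / 2) ^ J - (1 / 2) ^ (J + 1)) := by
        rw [pow_succ, one_div, inv_pow]; field_simp; ring
      have e3 : ε / 4 / (2 ^ J * m) = ε / 2 / m * ((1 / 2) ^ J - (1 / 2) ^ (J + 1)) := by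
        rw [pow_succ, one_div, inv_pow]; field_simp; ring
      rw [e2, e3] at h2
      rw [abs_le] at *
      constructor <;> linarith [h2.1, h2.2, ih.1, ih.2]
  have hpow : Tendsto (fun J : ℕ => 1 - (1 / 2 : ℝ) ^ J) atTop (𝓝 (1 - 0)) :=
    (tendsto_pow_atTop_nhds_zero_of_lt_one (by norm_num) (by norm_num)).const_sub 1
  have hsub : Tendsto (fun J : ℕ => 2 ^ J * m) atTop atTop :=
    (tendsto_pow_atTop_atTop_of_one_lt (by norm_num)).atTop_mul_const' (by omega)
  have hl := ((((hf.comp hsub).sub_const (f m)).sub (hpow.const_mul (2 * c / m))).abs)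
  have hr := hpow.const_mul (ε / 2 / m)
  have hle := le_of_tendsto_of_tendsto' hl hr key
  rw [Real.dist_eq]
  have e : (m : ℝ) * (l - f m) - 2 * c = m * (l - f m - 2 * c / m * (1 - 0)) := by field_simp; ring
  rw [e, abs_mul, abs_of_pos hm0]
  calc (m : ℝ) * |l - f m - 2 * c / m * (1 - 0)| ≤ m * (ε / 2 / m * (1 - 0)) := by gcongr
    _ = ε / 2 := by field_simp; ring
    _ < ε := by linarith

theorem IsPoissonProcess.tendsto_scan_sub_discrete {Ω : Type*} [MeasurableSpace Ω]
    {P : Measure Ω} [IsProbabilityMeasure P] {lam : ℝ} (hlam : 0 < lam) {p q k : ℕ} (hp : 0 < p)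
    (hpq : p < q) (hk : 0 < k) {w : ℝ} (hw : w = (p : ℝ) / q) {X : Ω → Finset ℝ}
    (hX : IsPoissonProcess lam X P) :
    Tendsto (fun m : ℕ => 2 * ((m : ℝ) * q) / lam ^ 2 *
        (P.real {ω | k ≤ scanStat w (X ω).val} -
          P.real {ω | k ≤ discreteScan (m * p) (cellCount (m * q) (X ω).val)})) atTop
      (𝓝 (1 / lam * (∫ ω, (nuFun w k (X ω) : ℝ) ∂P))) := by
  have hq : 0 < q := by omega
  have hq' : (0 : ℝ) < q := by exact_mod_cast hq
  have hlim := hX.tendsto_measureReal_discreteScan hk hpq hw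
  have hgap := (hX.integrable_nuFun_and_tendsto hlam.le hk hp hpq hw).2
  have hinv : Tendsto (fun m : ℕ => (lam ^ 3 + lam ^ 4) / q ^ 2 * (1 / (m : ℝ))) atTop (𝓝 0) := by
    simpa using tendsto_one_div_atTop_nhds_zero_nat.const_mul ((lam ^ 3 + lam ^ 4) / (q : ℝ) ^ 2)
  have hinc : Tendsto (fun m : ℕ => (m : ℝ) *
      (P.real {ω | k ≤ discreteScan (2 * m * p) (cellCount (2 * m * q) (X ω).val)} -
        P.real {ω | k ≤ discreteScan (m * p) (cellCount (m * q) (X ω).val)})) atTop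
      (𝓝 (lam / (4 * q) * ∫ ω, (nuFun w k (X ω) : ℝ) ∂P)) := by
    refine tendsto_of_tendsto_of_dist (hgap.const_mul (lam / (4 * q)))
      (squeeze_zero' (Eventually.of_forall fun _ => dist_nonneg) ?_ hinv)
    filter_upwards [eventually_gt_atTop 0] with m hm
    have hm' : (0 : ℝ) < m := by exact_mod_cast hm
    have key := hX.abs_refine_sub_le hlam.le hk (Nat.mul_pos hm hp)
      (Nat.mul_le_mul_left m hpq.le)
    rw [mul_assoc 2 m p, mul_assoc 2 m q, dist_comm, Real.dist_eq]
    set D := P.real {ω | k ≤ discreteScan (2 * (m * p)) (cellCount (2 * (m * q)) (X ω).val)} -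
        P.real {ω | k ≤ discreteScan (m * p) (cellCount (m * q) (X ω).val)}
    set I := ∫ ω, gapCount k (m * p) (m * q) (cellCount (m * q) (X ω).val) ∂P
    have e : (m : ℝ) * D - lam / (4 * q) * I = m * (D - lam / ((m * q : ℕ) : ℝ) / 4 * I) := by
      push_cast; field_simp
    rw [e, abs_mul, abs_of_pos hm']
    refine (mul_le_mul_of_nonneg_left key hm'.le).trans (le_of_eq ?_)
    push_cast
    field_simp
  -- Doubling the increment constant `lam / (4q)` and multiplying by `2q / lam²` gives `1 / lam`.
  have h := (tendsto_mul_sub_of_doubling (f := fun m : ℕ =>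
    P.real {ω | k ≤ discreteScan (m * p) (cellCount (m * q) (X ω).val)}) hlim hinc).const_mul
      (2 * q / lam ^ 2)
  refine (h.congr fun m => by ring).trans (le_of_eq ?_)
  congr 1
  field_simp
  ring

end

theorem theorem2p3 {Ω : Type*} [MeasurableSpace Ω] (P : Measure Ω) [IsProbabilityMeasure P]
    (lam : ℝ) (hlam : 0 < lam) (p q k : ℕ) (hp : 0 < p) (hpq : p < q) (hcop : p.Coprime q)
    (hk : 2 ≤ k) (w : ℝ) (hw : w = (p : ℝ) / (q : ℝ))
    (X : Ω → Finset ℝ) (hX : IsPoissonProcess lam X P)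
    {Ω' : ℕ → Type*} [∀ m, MeasurableSpace (Ω' m)] (P' : ∀ m, Measure (Ω' m))
    [∀ m, IsProbabilityMeasure (P' m)] (H : ∀ m : ℕ, Fin (m * q) → Ω' m → ℕ)
    (hH : ∀ m : ℕ, lam ≤ (m : ℝ) * q → IsBernoulliSeq (lam / ((m : ℝ) * q)) (H m) (P' m)) :
    Integrable (fun ω => (nuFun w k (X ω) : ℝ)) P ∧
    Integrable (fun ω => (nuTildeFun w k (X ω) : ℝ)) P ∧
    IntervalIntegrable (fun u : ℝ => P.real {ω | k ≤ scanStat w (u ::ₘ (X ω).val)}) volume 0 1 ∧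
    Tendsto
      (fun m : ℕ => 2 * ((m : ℝ) * q) / lam ^ 2 *
        (P.real {ω | k ≤ scanStat w (X ω).val} -
          (P' m).real {ω | k ≤ discreteScan (m * p) (fun r => H m r ω)}))
      atTop
      (𝓝 (1 / lam * (∫ ω, ((nuFun w k (X ω) : ℝ) + (nuTildeFun w k (X ω) : ℝ)) ∂P) +
        P.real {ω | k ≤ scanStat w (X ω).val} -
        ∫ u in (0 : ℝ)..1, P.real {ω | k ≤ scanStat w (u ::ₘ (X ω).val)})) := by
  have hk0 : 0 < k := by omega
  have hnu := (hX.integrable_nuFun_and_tendsto hlam.le hk0 hp hpq hw).1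
  have hnt := (hX.integrable_nuTildeFun_and_tendsto hk0 hpq hw).1
  refine ⟨hnu, hnt, hX.intervalIntegrable_measureReal_scanStat_cons hk0 hpq hw, ?_⟩
  -- The probability for the discrete scan of the Poisson cell counts is the intermediate term and
  -- cancels in the sum.
  have h := (hX.tendsto_scan_sub_discrete hlam hp hpq hk0 hw).add
    (hX.tendsto_discrete_sub_bernoulli hlam hpq hk0 hw P' H hH)
  rw [integral_add hnu hnt]
  convert h using 2
  · ring
  · ring
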